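/- **Conventions.** Let $\mathbb H$ be the complex upper half plane and $\Gamma(N)\subseteq SL_2(\mathbb Z)$, $N\ge 1$, the principal congruence subgroup of level $N$. For $k\in\mathbb Z$, $f:\mathbb H\to\mathbb C$ and $\alpha=\begin{pmatrix}a&b\\c&d\end{pmatrix}\in GL_2^+(\mathbb Q)$ put $(f|_k\alpha)(z)=(cz+d)^{-k}f\left(\frac{az+b}{cz+d}\right)$. Let $\mathcal M_k(\Gamma(N))$ be the space of modular forms of weight $k$ and level $\Gamma(N)$ (holomorphic at the cusps). A holomorphic function $f:\mathbb H\to\mathbb C$ is a quasimodular form of weight $k\ge 0$ and level $N$ if there are holomorphic functions $f_0,\dots,f_s:\mathbb H\to\mathbb C$ with $$(f|_k\gamma)(z)=\sum_{j=0}^s f_j(z)\left(\frac{c}{cz+d}\right)^j\qquad\text{for all }\gamma=\begin{pmatrix}a&b\\c&d\end{pmatrix}\in\Gamma(N),$$ and such that each $f_j|_{k-2j}\delta$ with $\delta\in SL_2(\mathbb Z)$ is bounded as $\mathrm{Im}(z)\to\infty$. Let $\mathcal M$ (the modular tower) and $\mathcal{QM}$ (the quasimodular tower) be the direct sums over the weights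 $k\ge 0$ of the spaces of modular, respectively quasimodular, forms of weight $k$ and arbitrary level $N\geq 1$ (and arbitrary depth). Let $G_K(z)=-\frac{B_K}{2K}+\sum_{n\ge1}\Big(\sum_{d|n}d^{K-1}\Big)e^{2\pi inz}$. Every $f\in\mathcal{QM}$ is uniquely a finite sum $f=\sum_i a_i(f)G_2^i$ with $a_i(f)\in\mathcal M$. For $\alpha\in GL_2^+(\mathbb Q)$ let $g\mapsto g|\alpha$ be the map on $\mathcal M$ that equals $g\mapsto g|_k\alpha$ in weight $k$, and put $f||\alpha=\sum_i(a_i(f)|\alpha)\,G_2^i$ for $f\in\mathcal{QM}$. **The algebra.** Let $\Gamma=\Gamma(N)$. Let $\mathcal Q(\Gamma)$ be the complex vector space of functions $F:\Gamma\backslash GL_2^+(\mathbb Q)\to\mathcal{QM}$, $\Gamma\alpha\mapsto F_\alpha$, of finite support with $F_{\alpha\gamma}=F_\alpha||\gamma$ for all $\gamma\in\Gamma$. Put $$(F^1*^rF^2)_\alpha=\sum_{\beta\in\Gamma\backslash SL_2(\mathbb Z)}F^1_\beta\cdot\big(F^2_{\alpha\beta^{-1}}||\beta\big),$$ and write $\mathcal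 Q^r(\Gamma)=(\mathcal Q(\Gamma),*^r)$. **The operators.** On $\mathcal{QM}$ put $D(f)=-\frac1{8\pi i}\sum_i i\,a_i(f)G_2^{i-1}G_2'$, where $G_2'$ is the derivative of $G_2$; $W_k(f)=\sum_i i\,a_i(f)G_2^{i+k-2}$ for $k\ge1$; $E(f)=G_4\cdot f$; and $T_k^l=E^lW_k$ for $k\ge 1$, $l\ge0$. They act on $\mathcal Q(\Gamma)$ by $D(F)_\alpha=D(F_\alpha)$ and $T_k^l(F)_\alpha=T_k^l(F_\alpha)$. For $m\ge1$ put $\nu_\alpha^{(m)}=-\frac5{24}(G_4^m|\alpha-G_4^m)$ and $\phi^{(m)}(F)_\alpha=\nu^{(m)}_\alpha\cdot F_\alpha$. **The Hopf algebra.** Let $\mathcal L$ be the complex Lie algebra with generators $D$, $T_k^l$ ($k\ge1$, $l\ge0$), $\phi^{(m)}$ ($m\ge1$) and relations $$[T_k^l,T_{k'}^{l'}]=(k'-k)T_{k+k'-2}^{l+l'},\qquad [T_k^l,D]=\tfrac5{24}(k-1)T_{k-1}^{l+1}-\tfrac12(k-3)T_{k+1}^l,$$ $$[D,\phi^{(m)}]=0,\qquad[T_k^l,\phi^{(m)}]=0,\qquad[\phi^{(m)},\phi^{(m')}]=0$$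 (a symbol $T_0^l$ occurs only with coefficient $0$). Let $\mathcal H=\mathcal U(\mathcal L)$ be its universal enveloping algebra, a Hopf algebra in which the elements of $\mathcal L$ are primitive: $\Delta(x)=x\otimes1+1\otimes x$. **Theorem.** Let $\Gamma=\Gamma(N)$, $N\ge1$, be a principal congruence subgroup. The product $*^r$ is well defined and makes $\mathcal Q^r(\Gamma)$ an associative (not necessarily unital) complex algebra. The operators $D$, $T_k^l$, $\phi^{(m)}$ on $\mathcal Q(\Gamma)$ are well defined and extend to an action of the algebra $\mathcal H$ on the vector space $\mathcal Q(\Gamma)$, in which each generator of $\mathcal L$ acts by the operator of the same name. This is a Hopf action of $\mathcal H$ on the algebra $\mathcal Q^r(\Gamma)$: $$h(F^1*^rF^2)=\sum h_{(1)}(F^1)*^rh_{(2)}(F^2)\qquad\text{for all }h\in\mathcal H,\ F^1,F^2\in\mathcal Q^r(\Gamma),$$ where $\Delta(h)=\sum h_{(1)}\otimes h_{(2)}$. -/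

import Mathlib

namespace QuasimodularHecke

open UpperHalfPlane Polynomial CongruenceSubgroup
open scoped MatrixGroups ModularForm Manifold DirectSum TensorProduct

/-! ### Enveloping algebras as Hopf algebras -/

section EnvelopingHopf

attribute [local instance 100] LieRing.ofAssociativeRing

variable (L : Type) [LieRing L] [LieAlgebra ℂ L]

local notation "U" => UniversalEnvelopingAlgebra ℂ L

/-- The coproduct of an enveloping algebra: the algebra map with `x ↦ x ⊗ 1 + 1 ⊗ x` on `L`. -/
noncomputable def envComul : U →ₐ[ℂ] U ⊗[ℂ] U :=
  UniversalEnvelopingAlgebra.lift ℂ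
    { toFun := fun x => UniversalEnvelopingAlgebra.ι ℂ x ⊗ₜ[ℂ] 1 +
        1 ⊗ₜ[ℂ] UniversalEnvelopingAlgebra.ι ℂ x
      map_add' := fun x y => by
        simp only [map_add, TensorProduct.add_tmul, TensorProduct.tmul_add]; abel
      map_smul' := fun c x => by
        simp only [map_smul, TensorProduct.smul_tmul', TensorProduct.tmul_smul, smul_add,
          RingHom.id_apply]
      map_lie' := fun {x y} => by
        simp only [LieHom.map_lie, LieRing.of_associative_ring_bracket, mul_add, add_mul,
          Algebra.TensorProduct.tmul_mul_tmul, one_mul, mul_one, TensorProduct.sub_tmul,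
          TensorProduct.tmul_sub]
        abel }

/-- The counit of an enveloping algebra, which kills `L`. -/
noncomputable def envCounit : U →ₐ[ℂ] ℂ := UniversalEnvelopingAlgebra.lift ℂ 0

/-- The antipode of an enveloping algebra: the anti-automorphism with `x ↦ -x` on `L`. -/
noncomputable def envAntipodeHom : U →ₐ[ℂ] (U)ᵐᵒᵖ :=
  UniversalEnvelopingAlgebra.lift ℂ
    { toFun := fun x => MulOpposite.op (-UniversalEnvelopingAlgebra.ι ℂ x)
      map_add' := fun x y => by simp only [map_add, neg_add, MulOpposite.op_add]
      map_smul' := fun c x => by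
        simp only [map_smul, RingHom.id_apply, ← MulOpposite.op_smul, smul_neg]
      map_lie' := fun {x y} => by
        simp only [LieHom.map_lie, LieRing.of_associative_ring_bracket, ← MulOpposite.op_mul,
          ← MulOpposite.op_sub]
        congr 1
        noncomm_ring }

theorem envComul_ι (x : L) : envComul L (UniversalEnvelopingAlgebra.ι ℂ x) =
    UniversalEnvelopingAlgebra.ι ℂ x ⊗ₜ[ℂ] 1 + 1 ⊗ₜ[ℂ] UniversalEnvelopingAlgebra.ι ℂ x :=
  UniversalEnvelopingAlgebra.lift_ι_apply ℂ _ x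

theorem envCounit_ι (x : L) : envCounit L (UniversalEnvelopingAlgebra.ι ℂ x) = 0 :=
  UniversalEnvelopingAlgebra.lift_ι_apply ℂ _ x

theorem envAntipodeHom_ι (x : L) : envAntipodeHom L (UniversalEnvelopingAlgebra.ι ℂ x) =
    MulOpposite.op (-UniversalEnvelopingAlgebra.ι ℂ x) :=
  UniversalEnvelopingAlgebra.lift_ι_apply ℂ _ x

theorem env_induction {P : U → Prop} (hι : ∀ x, P (UniversalEnvelopingAlgebra.ι ℂ x))
    (hc : ∀ c : ℂ, P (algebraMap ℂ U c)) (hadd : ∀ a b, P a → P b → P (a + b))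
    (hmul : ∀ a b, P a → P b → P (a * b)) (h : U) : P h := by
  obtain ⟨t, rfl⟩ : ∃ t, UniversalEnvelopingAlgebra.mkAlgHom ℂ L t = h := 
    RingCon.mkₐ_surjective _ h
  induction t using TensorAlgebra.induction with
  | algebraMap r => simpa using hc r
  | ι x => exact hι x
  | add a b ha hb => rw [map_add]; exact hadd _ _ ha hb
  | mul a b ha hb => rw [map_mul]; exact hmul _ _ ha hb

theorem env_hom_ext {A : Type*} [Ring A] [Algebra ℂ A] {f g : U →ₐ[ℂ] A}
    (h : ∀ x, f (UniversalEnvelopingAlgebra.ι ℂ x) = g (UniversalEnvelopingAlgebra.ι ℂ x)) :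
    f = g :=
  UniversalEnvelopingAlgebra.hom_ext ℂ (LieHom.ext h)

noncomputable instance envBialgebra : Bialgebra ℂ U :=
  Bialgebra.ofAlgHom (envComul L) (envCounit L)
    (by
      refine env_hom_ext L fun x => ?_
      simp only [AlgHom.comp_apply, envComul_ι, map_add, Algebra.TensorProduct.map_tmul,
        TensorProduct.add_tmul, TensorProduct.tmul_add, map_one, AlgHom.coe_id, id_eq,
        Algebra.TensorProduct.one_def, AlgEquiv.coe_toAlgHom,
        Algebra.TensorProduct.assoc_tmul]
      abel)
    (by
      refine env_hom_ext L fun x => ?_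
      simp [AlgHom.comp_apply, -UniversalEnvelopingAlgebra.ι_apply, envComul_ι, envCounit_ι])
    (by
      refine env_hom_ext L fun x => ?_
      simp [AlgHom.comp_apply, -UniversalEnvelopingAlgebra.ι_apply, envComul_ι, envCounit_ι])

/-- The antipode as a linear map. -/
noncomputable def envAntipode : U →ₗ[ℂ] U :=
  (MulOpposite.opLinearEquiv ℂ).symm.toLinearMap ∘ₗ (envAntipodeHom L).toLinearMap

theorem envAntipode_mul (a b : U) :
    envAntipode L (a * b) = envAntipode L b * envAntipode L a := by
  simp [envAntipode]

theorem envAntipode_ι (x : L) : envAntipode L (UniversalEnvelopingAlgebra.ι ℂ x) =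
    -UniversalEnvelopingAlgebra.ι ℂ x := by
  rw [envAntipode, LinearMap.comp_apply, AlgHom.toLinearMap_apply, envAntipodeHom_ι]
  simp

theorem envAntipode_left (h : U) (t : U ⊗[ℂ] U) :
    LinearMap.mul' ℂ U ((envAntipode L).rTensor U (envComul L h * t)) =
      envCounit L h • LinearMap.mul' ℂ U ((envAntipode L).rTensor U t) := by
  induction h using env_induction L generalizing t with
  | hι x =>
    rw [envCounit_ι, zero_smul, envComul_ι]
    induction t using TensorProduct.induction_on with
    | zero => simp
    | tmul u v =>
      simp only [add_mul, Algebra.TensorProduct.tmul_mul_tmul, one_mul, map_add,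
        LinearMap.rTensor_tmul, LinearMap.mul'_apply, envAntipode_mul, envAntipode_ι]
      noncomm_ring
    | add a b ha hb => rw [mul_add, map_add, map_add, ha, hb, add_zero]
  | hc c => simp [Algebra.algebraMap_eq_smul_one]
  | hadd a b ha hb => simp [add_mul, ha, hb, add_smul]
  | hmul a b ha hb => rw [map_mul (envComul L), mul_assoc, ha, hb, map_mul (envCounit L), smul_smul]

theorem envAntipode_right (h : U) (t : U ⊗[ℂ] U) :
    LinearMap.mul' ℂ U ((envAntipode L).lTensor U (t * envComul L h)) =
      envCounit L h • LinearMap.mul' ℂ U ((envAntipode L).lTensor U t) := by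
  induction h using env_induction L generalizing t with
  | hι x =>
    rw [envCounit_ι, zero_smul, envComul_ι]
    induction t using TensorProduct.induction_on with
    | zero => simp
    | tmul u v =>
      simp only [mul_add, Algebra.TensorProduct.tmul_mul_tmul, mul_one, map_add,
        LinearMap.lTensor_tmul, LinearMap.mul'_apply, envAntipode_mul, envAntipode_ι]
      noncomm_ring
    | add a b ha hb => rw [add_mul, map_add, map_add, ha, hb, add_zero]
  | hc c => simp [Algebra.algebraMap_eq_smul_one]
  | hadd a b ha hb => simp [mul_add, ha, hb, add_smul]
  | hmul a b ha hb => rw [map_mul (envComul L), ← mul_assoc, hb, ha, map_mul (envCounit L), smul_smul, mul_comm]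

/-- The enveloping algebra of a complex Lie algebra as a Hopf algebra. -/
noncomputable instance envHopfAlgebra : HopfAlgebra ℂ U where
  antipode := envAntipode L
  mul_antipode_rTensor_comul := by
    ext h
    have := envAntipode_left L h 1
    rw [mul_one] at this
    refine this.trans ?_
    have h1 : envAntipode L 1 = 1 := by simp [envAntipode]
    simp [Algebra.TensorProduct.one_def, h1, Algebra.algebraMap_eq_smul_one]
    rfl
  mul_antipode_lTensor_comul := by
    ext h
    have := envAntipode_right L h 1
    rw [one_mul] at this
    refine this.trans ?_
    have h1 : envAntipode L 1 = 1 := by simp [envAntipode]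
    simp [Algebra.TensorProduct.one_def, h1, Algebra.algebraMap_eq_smul_one]
    rfl

end EnvelopingHopf

/-! ### The Lie algebra and its Hopf algebra -/

/-- The generating symbols `D`, `T_k^l` (`k ≥ 1`, `l ≥ 0`) and `φ^(m)` (`m ≥ 1`). -/
inductive Gen : Type
  | D : Gen
  | T (k : ℕ+) (l : ℕ) : Gen
  | φ (m : ℕ+) : Gen

namespace Gen

/-- The symbols in the free Lie algebra. -/
noncomputable abbrev sym (g : Gen) : FreeLieAlgebra ℂ Gen := FreeLieAlgebra.of ℂ g

/-- The symbol `T_k^l` for a natural number `k`. The index `k = 0` only occurs with coefficient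
zero in the commutator relations; there the value is `0`. -/
noncomputable def symT (k l : ℕ) : FreeLieAlgebra ℂ Gen :=
  if hk : 0 < k then sym (T ⟨k, hk⟩ l) else 0

/-- The differences of the two sides of the commutator relations. -/
inductive Relator : FreeLieAlgebra ℂ Gen → Prop
  | TT (k k' : ℕ+) (l l' : ℕ) :
      Relator (⁅sym (T k l), sym (T k' l')⁆ -
        ((k' : ℂ) - (k : ℂ)) • symT ((k : ℕ) + (k' : ℕ) - 2) (l + l'))
  | Dφ (m : ℕ+) : Relator ⁅sym D, sym (φ m)⁆
  | Tφ (k : ℕ+) (l : ℕ) (m : ℕ+) : Relator ⁅sym (T k l), sym (φ m)⁆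
  | φφ (m m' : ℕ+) : Relator ⁅sym (φ m), sym (φ m')⁆
  | TD (k : ℕ+) (l : ℕ) :
      Relator (⁅sym (T k l), sym D⁆ -
        ((5 / 24 * ((k : ℂ) - 1)) • symT ((k : ℕ) - 1) (l + 1) -
          (1 / 2 * ((k : ℂ) - 3)) • symT ((k : ℕ) + 1) l))

end Gen

/-- The complex Lie algebra `L` with generators `D`, `T_k^l`, `φ^(m)` and the commutator
relations. -/
abbrev L : Type := FreeLieAlgebra ℂ Gen ⧸ LieSubmodule.lieSpan ℂ (FreeLieAlgebra ℂ Gen)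
  {x : FreeLieAlgebra ℂ Gen | Gen.Relator x}

/-- The Hopf algebra `H = U(L)`. -/
abbrev H : Type := UniversalEnvelopingAlgebra ℂ L

/-- The generators as elements of `H`. -/
noncomputable def Gen.toH (g : Gen) : H :=
  UniversalEnvelopingAlgebra.ι ℂ (LieSubmodule.Quotient.mk g.sym : L)

/-- The generators are primitive. -/
theorem comul_toH (g : Gen) :
    Coalgebra.comul (R := ℂ) g.toH = g.toH ⊗ₜ[ℂ] 1 + 1 ⊗ₜ[ℂ] g.toH :=
  envComul_ι L _

/-! ### Modular and quasimodular forms -/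

theorem modularForm_iff {N : ℕ} [NeZero N] {k : ℤ} {f : ℍ → ℂ} :
    (∃ g : ModularForm ((Gamma N).map (Matrix.SpecialLinearGroup.mapGL ℝ)) k, ⇑g = f) ↔
      MDiff f ∧ (∀ γ ∈ Gamma N, f ∣[k] γ = f) ∧
        ∀ δ : SL(2, ℤ), IsBoundedAtImInfty (f ∣[k] δ) := by
  constructor
  · rintro ⟨g, rfl⟩
    refine ⟨g.holo', fun γ hγ => ?_, fun δ => ModularFormClass.bdd_at_infty_slash g δ⟩
    exact g.slash_action_eq' _ ⟨γ, hγ, rfl⟩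
  · rintro ⟨h1, h2, h3⟩
    refine ⟨⟨⟨f, ?_⟩, h1, ?_⟩, rfl⟩
    · rintro _ ⟨γ, hγ, rfl⟩
      exact h2 γ hγ
    · intro c hc
      rw [Subgroup.IsArithmetic.isCusp_iff_isCusp_SL2Z] at hc
      rw [OnePoint.isBoundedAt_iff_forall_SL2Z hc]
      exact fun γ _ => h3 γ

/-- `f` is a modular form of weight `k` for some principal congruence subgroup `Γ(N)`. -/
def IsModular (k : ℤ) (f : ℍ → ℂ) : Prop :=
  ∃ N : ℕ, N ≠ 0 ∧
    ∃ g : ModularForm ((Gamma N).map (Matrix.SpecialLinearGroup.mapGL ℝ)) k, ⇑g = f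

/-- `f` is a quasimodular form of weight `k` on `Γ(N)`, with component functions
`f_j = P.coeff j`: all functions are holomorphic on the upper half plane, each `f_j` is bounded at
all cusps with respect to the weight `k - 2j`, and
`(cz+d)^(-k) f((az+b)/(cz+d)) = ∑ j, f_j(z) (c/(cz+d))^j` for all `(a b; c d)` in `Γ(N)`.
The depth is the degree of `P`, so the top component is nonzero unless `f = 0`. -/
structure IsQuasimodularWith (N : ℕ) (k : ℤ) (f : ℍ → ℂ) (P : (ℍ → ℂ)[X]) : Prop where
  holo : MDiff f
  coeff_holo : ∀ j, MDiff (P.coeff j)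
  coeff_bdd : ∀ j : ℕ, ∀ δ : SL(2, ℤ), IsBoundedAtImInfty (P.coeff j ∣[k - 2 * (j : ℤ)] δ)
  transf : ∀ γ ∈ Gamma N, ∀ z : ℍ, (f ∣[k] γ) z =
    P.sum fun j p => p z * ((γ 1 0 : ℂ) / denom γ z) ^ j

/-- `f` is a quasimodular form of weight `k` (of any depth) for some `Γ(N)`. -/
def IsQuasimodular (k : ℤ) (f : ℍ → ℂ) : Prop :=
  ∃ N : ℕ, N ≠ 0 ∧ ∃ P : (ℍ → ℂ)[X], IsQuasimodularWith N k f P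

theorem gamma_mono {N M : ℕ} (h : N ∣ M) : Gamma M ≤ Gamma N := by
  intro γ hγ
  rw [Gamma_mem] at hγ ⊢
  have key : ∀ a b : ℤ, (a : ZMod M) = (b : ZMod M) → (a : ZMod N) = (b : ZMod N) := by
    intro a b hab
    rw [ZMod.intCast_eq_intCast_iff] at hab ⊢
    exact hab.of_dvd (Int.natCast_dvd_natCast.mpr h)
  obtain ⟨h1, h2, h3, h4⟩ := hγ
  refine ⟨?_, ?_, ?_, ?_⟩
  · simpa using key _ 1 (by simpa using h1)
  · simpa using key _ 0 (by simpa using h2)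
  · simpa using key _ 0 (by simpa using h3)
  · simpa using key _ 1 (by simpa using h4)

theorem IsQuasimodularWith.mono {N M : ℕ} (h : N ∣ M) {k : ℤ} {f P}
    (hf : IsQuasimodularWith N k f P) : IsQuasimodularWith M k f P :=
  ⟨hf.holo, hf.coeff_holo, hf.coeff_bdd, fun γ hγ => hf.transf γ (gamma_mono h hγ)⟩

theorem IsQuasimodularWith.transf' {N : ℕ} {k : ℤ} {f P}
    (hf : IsQuasimodularWith N k f P) (γ : SL(2, ℤ)) (hγ : γ ∈ Gamma N) (z : ℍ) :
    (f ∣[k] γ) z = P.eval₂ (Pi.evalRingHom (fun _ : ℍ => ℂ) z) ((γ 1 0 : ℂ) / denom γ z) := by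
  rw [hf.transf γ hγ, eval₂_eq_sum]; rfl

theorem isQuasimodularWith_of {N : ℕ} {k : ℤ} {f : ℍ → ℂ} {P : (ℍ → ℂ)[X]} (h0 : MDiff f)
    (h1 : ∀ j, MDiff (P.coeff j))
    (h2 : ∀ j : ℕ, ∀ δ : SL(2, ℤ), IsBoundedAtImInfty (P.coeff j ∣[k - 2 * (j : ℤ)] δ))
    (h3 : ∀ γ ∈ Gamma N, ∀ z : ℍ, (f ∣[k] γ) z =
      P.eval₂ (Pi.evalRingHom (fun _ : ℍ => ℂ) z) ((γ 1 0 : ℂ) / denom γ z)) :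
    IsQuasimodularWith N k f P :=
  ⟨h0, h1, h2, fun γ hγ z => by rw [h3 γ hγ, eval₂_eq_sum]; rfl⟩

theorem bdd_add {f g : ℍ → ℂ} (hf : IsBoundedAtImInfty f) (hg : IsBoundedAtImInfty g) :
    IsBoundedAtImInfty (f + g) := (boundedAtImInftySubalgebra ℂ).add_mem hf hg

theorem bdd_mul {f g : ℍ → ℂ} (hf : IsBoundedAtImInfty f) (hg : IsBoundedAtImInfty g) :
    IsBoundedAtImInfty (f * g) := (boundedAtImInftySubalgebra ℂ).mul_mem hf hg

theorem bdd_smul (c : ℂ) {f : ℍ → ℂ} (hf : IsBoundedAtImInfty f) :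
    IsBoundedAtImInfty (c • f) := (boundedAtImInftySubalgebra ℂ).smul_mem hf c

theorem bdd_sum {ι : Type*} (s : Finset ι) {f : ι → ℍ → ℂ}
    (hf : ∀ i ∈ s, IsBoundedAtImInfty (f i)) : IsBoundedAtImInfty (∑ i ∈ s, f i) :=
  (boundedAtImInftySubalgebra ℂ).sum_mem hf

theorem mdiff_sum {ι : Type*} (s : Finset ι) {f : ι → ℍ → ℂ}
    (hf : ∀ i ∈ s, MDiff (f i)) : MDiff (∑ i ∈ s, f i) := by
  classical
  induction s using Finset.induction_on with
  | empty => simpa using! mdifferentiable_const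
  | insert a s ha ih =>
    rw [Finset.sum_insert ha]
    exact (hf a (by simp)).add (ih fun i hi => hf i (by simp [hi]))

theorem mdiff_smul (c : ℂ) {f : ℍ → ℂ} (hf : MDiff f) : MDiff (c • f) := hf.const_smul c

theorem IsQuasimodularWith.add {N : ℕ} {k : ℤ} {f g P Q}
    (hf : IsQuasimodularWith N k f P) (hg : IsQuasimodularWith N k g Q) :
    IsQuasimodularWith N k (f + g) (P + Q) := by
  refine isQuasimodularWith_of (hf.holo.add hg.holo) (fun j => ?_) (fun j δ => ?_)
    fun γ hγ z => ?_
  · rw [coeff_add]; exact (hf.coeff_holo j).add (hg.coeff_holo j)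
  · rw [coeff_add, SlashAction.add_slash]; exact bdd_add (hf.coeff_bdd j δ) (hg.coeff_bdd j δ)
  · rw [SlashAction.add_slash, Pi.add_apply, hf.transf' γ hγ, hg.transf' γ hγ, eval₂_add]

theorem IsQuasimodularWith.smul {N : ℕ} {k : ℤ} {f P} (c : ℂ)
    (hf : IsQuasimodularWith N k f P) : IsQuasimodularWith N k (c • f) (c • P) := by
  refine isQuasimodularWith_of (mdiff_smul c hf.holo) (fun j => ?_) (fun j δ => ?_)
    fun γ hγ z => ?_
  · rw [coeff_smul]; exact mdiff_smul c (hf.coeff_holo j)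
  · rw [coeff_smul, ModularForm.SL_smul_slash]; exact bdd_smul c (hf.coeff_bdd j δ)
  · have : c • P = C (fun _ => c) * P := by
      ext1 j; rw [coeff_smul, coeff_C_mul]; rfl
    rw [ModularForm.SL_smul_slash, Pi.smul_apply, hf.transf' γ hγ, this, eval₂_mul, eval₂_C]
    rfl

theorem IsQuasimodularWith.mul {N : ℕ} {k l : ℤ} {f g P Q}
    (hf : IsQuasimodularWith N k f P) (hg : IsQuasimodularWith N l g Q) :
    IsQuasimodularWith N (k + l) (f * g) (P * Q) := by
  refine isQuasimodularWith_of (hf.holo.mul hg.holo) (fun j => ?_) (fun j δ => ?_)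
    fun γ hγ z => ?_
  · rw [coeff_mul]
    exact mdiff_sum _ fun i _ => (hf.coeff_holo _).mul (hg.coeff_holo _)
  · rw [coeff_mul, SlashAction.sum_slash]
    refine bdd_sum _ fun i hi => ?_
    rw [Finset.HasAntidiagonal.mem_antidiagonal] at hi
    have : k + l - 2 * (j : ℤ) = (k - 2 * (i.1 : ℤ)) + (l - 2 * (i.2 : ℤ)) := by
      rw [← hi]; push_cast; ring
    rw [this, ModularForm.mul_slash_SL2]
    exact bdd_mul (hf.coeff_bdd _ δ) (hg.coeff_bdd _ δ)
  · rw [ModularForm.mul_slash_SL2, Pi.mul_apply, hf.transf' γ hγ, hg.transf' γ hγ, eval₂_mul]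

theorem isQuasimodularWith_C {N : ℕ} [NeZero N] {k : ℤ} {f : ℍ → ℂ}
    (hf : ∃ g : ModularForm ((Gamma N).map (Matrix.SpecialLinearGroup.mapGL ℝ)) k, ⇑g = f) :
    IsQuasimodularWith N k f (C f) := by
  obtain ⟨h1, h2, h3⟩ := modularForm_iff.mp hf
  refine isQuasimodularWith_of h1 (fun j => ?_) (fun j δ => ?_) fun γ hγ z => ?_
  · rw [coeff_C]; split_ifs
    · exact h1
    · exact mdifferentiable_const
  · rw [coeff_C]; split_ifs with h
    · simpa [h] using h3 δ
    · rw [SlashAction.zero_slash]; exact zero_form_isBoundedAtImInfty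
  · rw [h2 γ hγ, eval₂_C]; rfl

theorem IsModular.isQuasimodular {k : ℤ} {f : ℍ → ℂ} (hf : IsModular k f) :
    IsQuasimodular k f := by
  obtain ⟨N, hN, hg⟩ := hf
  have : NeZero N := ⟨hN⟩
  exact ⟨N, hN, _, isQuasimodularWith_C hg⟩

theorem isModular_iff {k : ℤ} {f : ℍ → ℂ} : IsModular k f ↔ ∃ N : ℕ, N ≠ 0 ∧
    MDiff f ∧ (∀ γ ∈ Gamma N, f ∣[k] γ = f) ∧
        ∀ δ : SL(2, ℤ), IsBoundedAtImInfty (f ∣[k] δ) := by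
  refine exists_congr fun N => and_congr_right fun hN => ?_
  have : NeZero N := ⟨hN⟩
  exact modularForm_iff

theorem IsModular.add {k : ℤ} {f g : ℍ → ℂ} (hf : IsModular k f) (hg : IsModular k g) :
    IsModular k (f + g) := by
  rw [isModular_iff] at *
  obtain ⟨N, hN, h1, h2, h3⟩ := hf
  obtain ⟨M, hM, h1', h2', h3'⟩ := hg
  refine ⟨N * M, mul_ne_zero hN hM, h1.add h1', fun γ hγ => ?_, fun δ => ?_⟩
  · rw [SlashAction.add_slash, h2 γ (gamma_mono (dvd_mul_right _ _) hγ),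
      h2' γ (gamma_mono (dvd_mul_left _ _) hγ)]
  · rw [SlashAction.add_slash]; exact bdd_add (h3 δ) (h3' δ)

theorem IsModular.mul {k l : ℤ} {f g : ℍ → ℂ} (hf : IsModular k f) (hg : IsModular l g) :
    IsModular (k + l) (f * g) := by
  rw [isModular_iff] at *
  obtain ⟨N, hN, h1, h2, h3⟩ := hf
  obtain ⟨M, hM, h1', h2', h3'⟩ := hg
  refine ⟨N * M, mul_ne_zero hN hM, h1.mul h1', fun γ hγ => ?_, fun δ => ?_⟩
  · rw [ModularForm.mul_slash_SL2, h2 γ (gamma_mono (dvd_mul_right _ _) hγ),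
      h2' γ (gamma_mono (dvd_mul_left _ _) hγ)]
  · rw [ModularForm.mul_slash_SL2]; exact bdd_mul (h3 δ) (h3' δ)

theorem IsModular.smul {k : ℤ} {f : ℍ → ℂ} (c : ℂ) (hf : IsModular k f) :
    IsModular k (c • f) := by
  rw [isModular_iff] at *
  obtain ⟨N, hN, h1, h2, h3⟩ := hf
  refine ⟨N, hN, mdiff_smul c h1, fun γ hγ => ?_, fun δ => ?_⟩
  · rw [ModularForm.SL_smul_slash, h2 γ hγ]
  · rw [ModularForm.SL_smul_slash]; exact bdd_smul c (h3 δ)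

theorem isModular_zero (k : ℤ) : IsModular k 0 :=
  ⟨1, one_ne_zero, 0, rfl⟩

theorem isModular_one : IsModular 0 1 :=
  ⟨1, one_ne_zero, 1, rfl⟩

/-- The modular forms of weight `k` and arbitrary level `Γ(N)`, `N ≥ 1`. -/
def modularSpace (k : ℕ) : Submodule ℂ (ℍ → ℂ) where
  carrier := {f | IsModular k f}
  add_mem' := IsModular.add
  zero_mem' := isModular_zero k
  smul_mem' c _ hf := hf.smul c

/-- The quasimodular forms of weight `k`, of arbitrary depth and arbitrary level
`Γ(N)`, `N ≥ 1`. -/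
def quasimodularSpace (k : ℕ) : Submodule ℂ (ℍ → ℂ) where
  carrier := {f | IsQuasimodular k f}
  add_mem' := by
    rintro f g ⟨N, hN, P, hP⟩ ⟨M, hM, Q, hQ⟩
    exact ⟨N * M, mul_ne_zero hN hM, P + Q,
      (hP.mono (dvd_mul_right _ _)).add (hQ.mono (dvd_mul_left _ _))⟩
  zero_mem' := (isModular_zero k).isQuasimodular
  smul_mem' := by
    rintro c f ⟨N, hN, P, hP⟩
    exact ⟨N, hN, _, hP.smul c⟩

instance modularGraded : SetLike.GradedMonoid modularSpace where
  one_mem := isModular_one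
  mul_mem i j f g hf hg := by
    have := IsModular.mul (k := i) (l := j) hf hg
    rwa [← Nat.cast_add] at this

instance quasimodularGraded : SetLike.GradedMonoid quasimodularSpace where
  one_mem := isModular_one.isQuasimodular
  mul_mem i j f g := by
    rintro ⟨N, hN, P, hP⟩ ⟨M, hM, Q, hQ⟩
    refine ⟨N * M, mul_ne_zero hN hM, P * Q, ?_⟩
    rw [Nat.cast_add]
    exact (hP.mono (dvd_mul_right _ _)).mul (hQ.mono (dvd_mul_left _ _))

/-! ### The towers -/

/-- The direct sum `⨁ k, A k` of a multiplicative family of spaces of functions on the upper half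
plane, with its ring structure. -/
def Tower (A : ℕ → Submodule ℂ (ℍ → ℂ)) : Type := ⨁ k : ℕ, A k

namespace Tower

variable (A : ℕ → Submodule ℂ (ℍ → ℂ)) [SetLike.GradedMonoid A]

noncomputable instance : CommRing (Tower A) := inferInstanceAs (CommRing (⨁ k : ℕ, A k))

noncomputable instance : Algebra ℂ (Tower A) := inferInstanceAs (Algebra ℂ (⨁ k : ℕ, A k))

/-- The element of the tower given by a function of weight `k`. -/
noncomputable def of (k : ℕ) : A k →ₗ[ℂ] Tower A := DirectSum.lof ℂ ℕ (fun k => A k) k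

/-- The component of weight `k`. -/
noncomputable def component (k : ℕ) : Tower A →ₗ[ℂ] A k := DirectSum.component ℂ ℕ (fun k => A k) k

variable {A}

theorem ext {x y : Tower A} (h : ∀ k, component A k x = component A k y) : x = y :=
  DFinsupp.ext h

theorem component_of (k : ℕ) (a : A k) (n : ℕ) :
    ((component A n (of A k a) : A n) : ℍ → ℂ) = if k = n then (a : ℍ → ℂ) else 0 := by
  split_ifs with h
  · subst h
    exact congrArg Subtype.val (DirectSum.of_eq_same (β := fun k => A k) k a)
  · exact congrArg Subtype.val (DirectSum.of_eq_of_ne (β := fun k => A k) k n a (Ne.symm h))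

theorem induction {P : Tower A → Prop} (h0 : P 0) (hof : ∀ k a, P (of A k a))
    (hadd : ∀ x y, P x → P y → P (x + y)) (x : Tower A) : P x :=
  DirectSum.induction_on x h0 hof hadd

theorem of_mul_of {i j : ℕ} (a : A i) (b : A j) : of A i a * of A j b =
    of A (i + j) ⟨(a : ℍ → ℂ) * b, SetLike.mul_mem_graded a.2 b.2⟩ :=
  DirectSum.of_mul_of (A := fun k => A k) a b

theorem one_eq : (1 : Tower A) = of A 0 ⟨1, SetLike.one_mem_graded A⟩ := rfl

theorem component_mul_of (r : Tower A) {i : ℕ} (b : A i) (n : ℕ) :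
    ((component A n (r * of A i b) : A n) : ℍ → ℂ) =
      if i ≤ n then (component A (n - i) r : ℍ → ℂ) * b else 0 :=
  DirectSum.coe_mul_of_apply A r b n

/-- The algebra map between towers given by multiplicative linear maps in each weight. -/
noncomputable def map {B : ℕ → Submodule ℂ (ℍ → ℂ)} [SetLike.GradedMonoid B]
    (f : ∀ k, A k →ₗ[ℂ] B k)
    (hone : (f 0 ⟨1, SetLike.one_mem_graded A⟩ : ℍ → ℂ) = 1)
    (hmul : ∀ i j (a : A i) (b : A j),
      (f (i + j) ⟨(a : ℍ → ℂ) * b, SetLike.mul_mem_graded a.2 b.2⟩ : ℍ → ℂ) = f i a * f j b) :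
    Tower A →ₐ[ℂ] Tower B :=
  DirectSum.toAlgebra (B := Tower B) ℂ (fun k => A k) (fun k => (of B k).comp (f k))
    (by
      rw [one_eq]
      exact congrArg (of B 0) (Subtype.ext hone))
    (fun {i j} a b => by
      rw [LinearMap.comp_apply, LinearMap.comp_apply, LinearMap.comp_apply, of_mul_of]
      exact congrArg (of B (i + j)) (Subtype.ext (hmul i j a b)))

theorem map_of {B : ℕ → Submodule ℂ (ℍ → ℂ)} [SetLike.GradedMonoid B]
    (f : ∀ k, A k →ₗ[ℂ] B k) (hone hmul) (k : ℕ) (a : A k) :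
    map f hone hmul (of A k a) = of B k (f k a) :=
  DirectSum.toAddMonoid_of (fun k => ((of B k).comp (f k)).toAddMonoidHom) k a

end Tower

/-- The modular tower `M`, the direct sum over the weights of the modular forms of all levels. -/
abbrev MTower : Type := Tower modularSpace

/-- The quasimodular tower `QM`. -/
abbrev QMTower : Type := Tower quasimodularSpace

theorem modularSpace_le (k : ℕ) : modularSpace k ≤ quasimodularSpace k :=
  fun _ hf => IsModular.isQuasimodular hf

/-- The inclusion of the modular tower in the quasimodular tower. -/
noncomputable def incl : MTower →ₐ[ℂ] QMTower :=
  Tower.map (fun k => Submodule.inclusion (modularSpace_le k)) rfl fun _ _ _ _ => rfl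

theorem incl_of (k : ℕ) (a : modularSpace k) : incl (Tower.of modularSpace k a) =
    Tower.of quasimodularSpace k ⟨a, modularSpace_le k a.2⟩ :=
  Tower.map_of (fun k => Submodule.inclusion (modularSpace_le k)) rfl (fun _ _ _ _ => rfl) k a

/-! ### Eisenstein series -/

/-- The Eisenstein series
`G_K(z) = -B_K / (2K) + ∑_{n ≥ 1} (∑_{d ∣ n} d^(K-1)) e^(2πinz)`. -/
noncomputable def eisensteinG (K : ℕ) (z : ℍ) : ℂ :=
  -(_root_.bernoulli K : ℂ) / (2 * K) + ∑' n : ℕ+, (∑ d ∈ (n : ℕ).divisors, (d : ℂ) ^ (K - 1)) *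
    Complex.exp (2 * Real.pi * Complex.I * (n : ℕ) * z)

theorem eisensteinG_four : eisensteinG 4 = (1 / 240 : ℂ) • ⇑ModularForm.E₄ := by
  ext z
  have h := EisensteinSeries.q_expansion_bernoulli (k := 4) (by norm_num) (by decide) z
  have hb : _root_.bernoulli 4 = -1 / 30 := by
    rw [bernoulli_eq_bernoulli'_of_ne_one (by norm_num)]; exact bernoulli'_four
  rw [Pi.smul_apply]
  erw [h]
  rw [eisensteinG, hb]
  have : ∀ n : ℕ+, (∑ d ∈ (n : ℕ).divisors, (d : ℂ) ^ (4 - 1)) *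
      Complex.exp (2 * Real.pi * Complex.I * (n : ℕ) * z) =
      (ArithmeticFunction.sigma (4 - 1) (n : ℕ) : ℂ) *
        Complex.exp (2 * Real.pi * Complex.I * z) ^ ((n : ℕ) : ℤ) := by
    intro n
    rw [ArithmeticFunction.sigma_apply, zpow_natCast, ← Complex.exp_nat_mul]
    push_cast
    congr 2
    ring
  simp_rw [this]
  push_cast
  rw [smul_eq_mul]
  ring_nf

theorem eisensteinG_two : eisensteinG 2 = (-1 / 24 : ℂ) • EisensteinSeries.E2 := by
  ext z
  have h := EisensteinSeries.E2_eq_tsum_cexp z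
  have hb : _root_.bernoulli 2 = 1 / 6 := by
    rw [bernoulli_eq_bernoulli'_of_ne_one (by norm_num)]; exact bernoulli'_two
  rw [Pi.smul_apply, h, eisensteinG, hb]
  have : ∀ n : ℕ+, (∑ d ∈ (n : ℕ).divisors, (d : ℂ) ^ (2 - 1)) *
      Complex.exp (2 * Real.pi * Complex.I * (n : ℕ) * z) =
      (ArithmeticFunction.sigma 1 (n : ℕ) : ℂ) *
        Complex.exp (2 * Real.pi * Complex.I * z) ^ (n : ℕ) := by
    intro n
    rw [ArithmeticFunction.sigma_apply, ← Complex.exp_nat_mul]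
    push_cast
    congr 2
    ring
  simp_rw [this]
  push_cast
  rw [smul_eq_mul]
  ring

theorem isModular_eisensteinG_four : IsModular 4 (eisensteinG 4) := by
  rw [eisensteinG_four]
  refine IsModular.smul _ ⟨1, one_ne_zero, ?_⟩
  have : (Gamma 1).map (Matrix.SpecialLinearGroup.mapGL ℝ) = 𝒮ℒ := by
    rw [Gamma_one_coe_eq_SL]
  exact ⟨ModularForm.E₄.copy _ rfl this, rfl⟩

/-- The constant in the transformation law of `G_2`. -/
noncomputable def g2const : ℂ := Complex.I / (4 * Real.pi)

theorem g2const_ne_zero : g2const ≠ 0 := by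
  simp [g2const, Real.pi_ne_zero]

/-- The cocycle `c / (cz + d)`. -/
noncomputable def cocyc (γ : SL(2, ℤ)) (z : ℍ) : ℂ := (γ 1 0 : ℂ) / denom γ z

theorem eisensteinG_two_slash (γ : SL(2, ℤ)) :
    eisensteinG 2 ∣[(2 : ℤ)] γ = eisensteinG 2 + g2const • cocyc γ := by
  rw [eisensteinG_two, ModularForm.SL_smul_slash, EisensteinSeries.E2_slash_action, smul_sub,
    sub_eq_add_neg]
  congr 1
  ext z
  simp only [Pi.neg_apply, Pi.smul_apply, EisensteinSeries.D2, cocyc, smul_eq_mul, g2const,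
    riemannZeta_two]
  have := Real.pi_ne_zero
  have : (Real.pi : ℂ) ≠ 0 := by exact_mod_cast this
  field_simp
  ring

theorem mdiff_eisensteinG_two : MDiff (eisensteinG 2) := by
  rw [eisensteinG_two]; exact mdiff_smul _ E2_mdifferentiable

theorem bdd_eisensteinG_two : IsBoundedAtImInfty (eisensteinG 2) := by
  rw [eisensteinG_two]; exact bdd_smul _ EisensteinSeries.isBoundedAtImInfty_E2

theorem bdd_cocyc (γ : SL(2, ℤ)) : IsBoundedAtImInfty (cocyc γ) := by
  rw [isBoundedAtImInfty_iff]
  refine ⟨1, 1, fun z hz => ?_⟩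
  by_cases hc : γ 1 0 = 0
  · simp [cocyc, hc]
  · have h1 : |(γ 1 0 : ℝ)| ≤ ‖denom γ z‖ := by
      have h2 : (denom γ z).im = (γ 1 0 : ℝ) * z.im := by
        rw [ModularGroup.denom_apply]; simp
      calc |(γ 1 0 : ℝ)| ≤ |(γ 1 0 : ℝ) * z.im| := by
            rw [abs_mul]; exact le_mul_of_one_le_right (abs_nonneg _) (hz.trans (le_abs_self _))
        _ ≤ _ := by rw [← h2]; exact Complex.abs_im_le_norm _
    rw [cocyc, norm_div]
    refine div_le_one_of_le₀ ?_ (norm_nonneg _)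
    rw [Complex.norm_intCast]; exact h1

theorem isQuasimodularWith_eisensteinG_two :
    IsQuasimodularWith 1 2 (eisensteinG 2) (C (eisensteinG 2) + C (fun _ => g2const) * X) := by
  refine isQuasimodularWith_of mdiff_eisensteinG_two (fun j => ?_) (fun j δ => ?_)
    fun γ _ z => ?_
  · match j with
    | 0 => simpa using mdiff_eisensteinG_two
    | 1 => simpa [coeff_C] using! mdifferentiable_const
    | j + 2 => simpa [coeff_C, coeff_X] using! mdifferentiable_const
  · match j with
    | 0 =>
      simp only [coeff_add, coeff_C_zero, mul_coeff_zero, coeff_X_zero, mul_zero, add_zero,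
        Nat.cast_zero, sub_zero]
      rw [eisensteinG_two_slash]
      exact bdd_add bdd_eisensteinG_two (bdd_smul _ (bdd_cocyc δ))
    | 1 =>
      have : (C (eisensteinG 2) + C (fun _ : ℍ => g2const) * X).coeff 1 =
        fun _ => g2const := by simp [coeff_C]
      rw [this]
      have h := ModularForm.is_invariant_const δ g2const
      simp only [Nat.cast_one, mul_one, sub_self]
      erw [h]
      exact Filter.const_boundedAtFilter _ _
    | j + 2 =>
      have : (C (eisensteinG 2) + C (fun _ : ℍ => g2const) * X).coeff (j + 2) = 0 := by
        simp [coeff_X]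
      rw [this, SlashAction.zero_slash]
      exact zero_form_isBoundedAtImInfty
  · rw [eisensteinG_two_slash]
    simp [cocyc]

/-- The derivative `G_2'`. -/
noncomputable def eisensteinG2' (z : ℍ) : ℂ := deriv (eisensteinG 2 ∘ ofComplex) z

theorem eisensteinG2'_eq : eisensteinG2' =
    (2 * Real.pi * Complex.I : ℂ) • Derivative.normalizedDerivOfComplex (eisensteinG 2) := by
  ext z
  rw [Pi.smul_apply, Derivative.normalizedDerivOfComplex, smul_eq_mul,
    mul_inv_cancel_left₀ Complex.two_pi_I_ne_zero, eisensteinG2']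

theorem mdiff_cocyc (γ : SL(2, ℤ)) : MDiff (cocyc γ) := by
  have h := EisensteinSeries.E2_slash_action γ
  have h2 : g2const • cocyc γ = eisensteinG 2 ∣[(2 : ℤ)] γ - eisensteinG 2 := by
    rw [eisensteinG_two_slash]; abel
  have h3 : MDiff (g2const • cocyc γ) := by
    rw [h2]
    exact (MDifferentiable.slash mdiff_eisensteinG_two 2 _).sub mdiff_eisensteinG_two
  have h4 := mdiff_smul g2const⁻¹ h3
  rwa [inv_smul_smul₀ g2const_ne_zero] at h4

theorem deriv_cocyc (γ : SL(2, ℤ)) (z : ℍ) :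
    deriv (cocyc γ ∘ ofComplex) z = -(cocyc γ z) ^ 2 := by
  have hd := hasDerivAt_denom_zpow (γ : GL (Fin 2) ℝ) (-1) z
  have hne : denom γ z ≠ 0 := denom_ne_zero _ z
  have h1 : (cocyc γ ∘ ofComplex) =ᶠ[nhds (z : ℂ)]
      fun w => (γ 1 0 : ℂ) * denom γ w ^ (-1 : ℤ) := by
    filter_upwards [isOpen_upperHalfPlaneSet.mem_nhds z.im_pos] with w hw
    simp only [Function.comp_apply, cocyc, ofComplex_apply_of_im_pos hw, zpow_neg_one]
    rfl
  rw [h1.deriv_eq, (hd.const_mul _).deriv, cocyc]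
  have h2 : (((γ : GL (Fin 2) ℝ) 1 0 : ℝ) : ℂ) = (γ 1 0 : ℂ) := by simp
  rw [h2, show (-1 - 1 : ℤ) = -2 by norm_num, zpow_neg, div_pow]
  push_cast
  field_simp

theorem eisensteinG2'_slash (γ : SL(2, ℤ)) (z : ℍ) :
    (eisensteinG2' ∣[(4 : ℤ)] γ) z = eisensteinG2' z + 2 * eisensteinG 2 z * cocyc γ z +
      g2const * cocyc γ z ^ 2 := by
  have h := congrFun (Derivative.normalizedDerivOfComplex_SL_slash (k := 2)
    mdiff_eisensteinG_two (γ := γ)) z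
  rw [eisensteinG_two_slash, Derivative.normalizedDerivOfComplex_add _ _ mdiff_eisensteinG_two
    (mdiff_smul _ (mdiff_cocyc γ)), Derivative.normalizedDerivOfComplex_smul _ _ (mdiff_cocyc γ)]
    at h
  simp only [Pi.add_apply, Pi.sub_apply, Pi.smul_apply, smul_eq_mul] at h
  have h3 : Derivative.normalizedDerivOfComplex (cocyc γ) z =
      (2 * Real.pi * Complex.I)⁻¹ * (-(cocyc γ z) ^ 2) := by
    rw [Derivative.normalizedDerivOfComplex, deriv_cocyc]
  rw [h3] at h
  have h4 : ((2 : ℤ) + 2) = 4 := by norm_num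
  rw [h4] at h
  rw [eisensteinG2'_eq, ModularForm.SL_smul_slash, Pi.smul_apply, Pi.smul_apply, smul_eq_mul,
    smul_eq_mul, sub_eq_iff_eq_add.mp h.symm]
  have hc : (γ 1 0 : ℂ) / denom γ z = cocyc γ z := rfl
  rw [hc]
  have := Complex.two_pi_I_ne_zero
  field_simp
  push_cast
  ring

theorem bdd_eisensteinG2' : IsBoundedAtImInfty eisensteinG2' := by
  obtain ⟨C, A, hA⟩ := isBoundedAtImInfty_iff.mp bdd_eisensteinG_two
  rw [isBoundedAtImInfty_iff]
  refine ⟨C / 1, max A 0 + 2, fun z hz => ?_⟩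
  have hdiff := UpperHalfPlane.mdifferentiable_iff.mp mdiff_eisensteinG_two
  have him : ∀ w ∈ Metric.closedBall (z : ℂ) 1, max A 0 + 1 ≤ w.im := by
    intro w hw
    rw [mem_closedBall_iff_norm] at hw
    have h1 := (Complex.abs_im_le_norm (w - z)).trans hw
    rw [Complex.sub_im, abs_le] at h1
    have : (z : ℂ).im = z.im := rfl
    linarith [h1.1]
  refine Complex.norm_deriv_le_of_forall_mem_sphere_norm_le one_pos ?_ ?_
  · refine DifferentiableOn.diffContOnCl_ball (U := upperHalfPlaneSet) hdiff ?_
    intro w hw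
    have := him w hw
    exact lt_of_lt_of_le (by positivity) this
  · intro w hw
    have h1 := him w (Metric.sphere_subset_closedBall hw)
    have h2 : 0 < w.im := lt_of_lt_of_le (by positivity) h1
    rw [Function.comp_apply, ofComplex_apply_of_im_pos h2]
    refine hA _ ?_
    change A ≤ w.im
    linarith [le_max_left A 0]

theorem isQuasimodularWith_eisensteinG2' :
    IsQuasimodularWith 1 4 eisensteinG2'
      (C eisensteinG2' + C ((2 : ℂ) • eisensteinG 2) * X + C (fun _ => g2const) * X ^ 2) := by
  have hm : MDiff eisensteinG2' := by
    rw [eisensteinG2'_eq]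
    exact mdiff_smul _ (Derivative.normalizedDerivOfComplex_mdifferentiable mdiff_eisensteinG_two)
  have c0 : (C eisensteinG2' + C ((2 : ℂ) • eisensteinG 2) * X +
      C (fun _ : ℍ => g2const) * X ^ 2).coeff 0 = eisensteinG2' := by simp
  have c1 : (C eisensteinG2' + C ((2 : ℂ) • eisensteinG 2) * X +
      C (fun _ : ℍ => g2const) * X ^ 2).coeff 1 = (2 : ℂ) • eisensteinG 2 := by
    simp [coeff_C, coeff_X_pow]
  have c2 : (C eisensteinG2' + C ((2 : ℂ) • eisensteinG 2) * X +
      C (fun _ : ℍ => g2const) * X ^ 2).coeff 2 = fun _ => g2const := by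
    simp [coeff_C, coeff_X]
  have c3 : ∀ j, (C eisensteinG2' + C ((2 : ℂ) • eisensteinG 2) * X +
      C (fun _ : ℍ => g2const) * X ^ 2).coeff (j + 3) = 0 := by
    intro j; simp [coeff_C, coeff_X, coeff_X_pow]
  refine isQuasimodularWith_of hm (fun j => ?_) (fun j δ => ?_) fun γ _ z => ?_
  · match j with
    | 0 => rw [c0]; exact hm
    | 1 => rw [c1]; exact mdiff_smul _ mdiff_eisensteinG_two
    | 2 => rw [c2]; exact mdifferentiable_const
    | j + 3 => rw [c3]; exact mdifferentiable_const
  · match j with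
    | 0 =>
      rw [c0]
      have : eisensteinG2' ∣[(4 : ℤ) - 2 * ((0 : ℕ) : ℤ)] δ = eisensteinG2' +
          (2 : ℂ) • (eisensteinG 2 * cocyc δ) + g2const • (cocyc δ * cocyc δ) := by
        ext z
        simp only [Nat.cast_zero, mul_zero, sub_zero]
        rw [eisensteinG2'_slash]
        simp only [Pi.add_apply, Pi.smul_apply, Pi.mul_apply, smul_eq_mul]
        ring
      rw [this]
      exact bdd_add (bdd_add bdd_eisensteinG2'
        (bdd_smul _ (bdd_mul bdd_eisensteinG_two (bdd_cocyc δ))))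
        (bdd_smul _ (bdd_mul (bdd_cocyc δ) (bdd_cocyc δ)))
    | 1 =>
      rw [c1, ModularForm.SL_smul_slash]
      simp only [Nat.cast_one, mul_one]
      rw [show (4 : ℤ) - 2 = 2 by norm_num, eisensteinG_two_slash]
      exact bdd_smul _ (bdd_add bdd_eisensteinG_two (bdd_smul _ (bdd_cocyc δ)))
    | 2 =>
      rw [c2]
      have h := ModularForm.is_invariant_const δ g2const
      rw [show (4 : ℤ) - 2 * ((2 : ℕ) : ℤ) = 0 by norm_num]
      erw [h]
      exact Filter.const_boundedAtFilter _ _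
    | j + 3 =>
      rw [c3, SlashAction.zero_slash]
      exact zero_form_isBoundedAtImInfty
  · rw [eisensteinG2'_slash]
    simp [cocyc]

/-! ### Every quasimodular form is uniquely a polynomial in `G_2` over the modular forms -/

theorem cocyc_mul (A B : SL(2, ℤ)) (z : ℍ) :
    cocyc (A * B) z = cocyc A (B • z) * denom B z ^ (-2 : ℤ) + cocyc B z := by
  have h := congrFun (EisensteinSeries.D2_mul A B) z
  rw [Pi.add_apply, ModularForm.SL_slash_apply] at h
  have e : ∀ (γ : SL(2, ℤ)) (w : ℍ), EisensteinSeries.D2 γ w =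
      2 * Real.pi * Complex.I * cocyc γ w := by
    intro γ w; rw [EisensteinSeries.D2, cocyc, mul_div_assoc]
  rw [e, e, e] at h
  refine mul_left_cancel₀ Complex.two_pi_I_ne_zero ?_
  rw [h]; ring

/-- The lower unipotent matrices in `Γ(N)`. -/
def unip (N m : ℕ) : SL(2, ℤ) := ⟨!![1, 0; (N * m : ℤ), 1], by simp⟩

theorem unip_mem (N m : ℕ) : unip N m ∈ Gamma N := by
  rw [Gamma_mem]; simp [unip]

theorem cocyc_unip_injective {N : ℕ} (hN : N ≠ 0) (z : ℍ) :
    Function.Injective fun m : ℕ => cocyc (unip N m) z := by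
  intro m m' h
  have hd : ∀ n : ℕ, denom (unip N n) z = (N * n : ℂ) * z + 1 := by
    intro n; rw [ModularGroup.denom_apply]; simp [unip]
  have hne : ∀ n : ℕ, (N * n : ℂ) * z + 1 ≠ 0 := by
    intro n; rw [← hd]; exact denom_ne_zero _ _
  have hc : ∀ n : ℕ, cocyc (unip N n) z = (N * n : ℂ) / ((N * n : ℂ) * z + 1) := by
    intro n; rw [cocyc, hd]; simp [unip]
  simp only [hc] at h
  rw [div_eq_div_iff (hne _) (hne _)] at h
  have h2 : (N * m : ℂ) = N * m' := by linear_combination h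
  have h3 : (N : ℂ) ≠ 0 := by exact_mod_cast hN
  exact_mod_cast mul_left_cancel₀ h3 h2

theorem coeff_comp_linear {n : ℕ} (p : ℂ[X]) (hp : p.natDegree ≤ n) (a b : ℂ) :
    (p.comp (C a * X + C b)).coeff n = p.coeff n * a ^ n := by
  have hl : (C a * X + C b).natDegree ≤ 1 := natDegree_linear_le
  conv_lhs => rw [p.as_sum_range' (n + 1) (Nat.lt_succ_of_le hp)]
  rw [Polynomial.sum_comp, finsetSum_coeff, Finset.sum_range_succ, Finset.sum_eq_zero, zero_add]
  · rw [monomial_comp, coeff_C_mul]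
    have := coeff_pow_of_natDegree_le (m := n) hl
    rw [mul_one] at this
    rw [this]; simp
  · intro i hi
    rw [Finset.mem_range] at hi
    rw [monomial_comp, coeff_C_mul,
      coeff_eq_zero_of_natDegree_lt (p := (C a * X + C b) ^ i), mul_zero]
    exact lt_of_le_of_lt (natDegree_pow_le_of_le i hl) (by omega)

theorem IsQuasimodularWith.top_slash {N : ℕ} (hN : N ≠ 0) {k : ℤ} {f P}
    (hf : IsQuasimodularWith N k f P) {n : ℕ} (hn : P.natDegree ≤ n) (γ : SL(2, ℤ))
    (hγ : γ ∈ Gamma N) : P.coeff n ∣[k - 2 * (n : ℤ)] γ = P.coeff n := by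
  ext z
  set w : ℍ := γ • z with hw
  set j : ℂ := denom γ z with hj
  have hj0 : j ≠ 0 := denom_ne_zero _ _
  set ev : ℍ → (ℍ → ℂ) →+* ℂ := fun z => Pi.evalRingHom (fun _ : ℍ => ℂ) z with hev
  have key : (P.map (ev z)).comp (C (j ^ (-2 : ℤ)) * X + C (cocyc γ z)) =
      C (j ^ (-k)) * P.map (ev w) := by
    refine eq_of_infinite_eval_eq _ _ ((Set.infinite_range_of_injective
      (cocyc_unip_injective hN w)).mono ?_)
    rintro _ ⟨m, rfl⟩
    have h1 := hf.transf' (unip N m * γ) (mul_mem (unip_mem N m) hγ) z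
    rw [SlashAction.slash_mul, ModularForm.SL_slash_apply, hf.transf' _ (unip_mem N m)] at h1
    have h2 : ((unip N m * γ) 1 0 : ℂ) / denom (unip N m * γ : SL(2, ℤ)) z =
      cocyc (unip N m) w * j ^ (-2 : ℤ) + cocyc γ z := cocyc_mul _ _ _
    rw [h2] at h1
    simp only [Set.mem_ofPred_eq, eval_comp, eval_add, eval_mul, eval_C, eval_X, eval_map]
    rw [mul_comm (j ^ (-2 : ℤ)), ← h1, mul_comm]
    rfl
  have h3 := congrArg (fun p => coeff p n) key
  rw [coeff_comp_linear _ (natDegree_map_le.trans hn), coeff_C_mul, coeff_map, coeff_map] at h3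
  simp only [hev, Pi.evalRingHom_apply] at h3
  rw [ModularForm.SL_slash_apply, ← hw, ← hj]
  have h4 : j ^ (-(k - 2 * (n : ℤ))) = j ^ (-k) * (j ^ (2 : ℤ)) ^ n := by
    rw [← zpow_natCast, ← zpow_mul, ← zpow_add₀ hj0]; congr 1; ring
  rw [h4, ← mul_assoc, mul_comm (P.coeff n w), ← h3, mul_assoc, ← mul_pow, ← zpow_add₀ hj0]
  simp

/-- `G_2` as an element of the quasimodular tower. -/
noncomputable def G2 : QMTower :=
  Tower.of quasimodularSpace 2
    ⟨eisensteinG 2, 1, one_ne_zero, _, isQuasimodularWith_eisensteinG_two⟩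

/-- The derivative `G_2'` as an element of the quasimodular tower. -/
noncomputable def G2' : QMTower :=
  Tower.of quasimodularSpace 4
    ⟨eisensteinG2', 1, one_ne_zero, _, isQuasimodularWith_eisensteinG2'⟩

/-- `G_4` as an element of the modular tower. -/
noncomputable def G4 : MTower :=
  Tower.of modularSpace 4 ⟨eisensteinG 4, isModular_eisensteinG_four⟩

/-- Evaluation of polynomials over the modular tower at `G_2`. -/
noncomputable def evalG2 : MTower[X] →ₐ[ℂ] QMTower :=
  Polynomial.eval₂AlgHom incl G2 fun _ => Commute.all _ _

theorem coe_incl (x : MTower) (m : ℕ) :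
    (Tower.component quasimodularSpace m (incl x) : ℍ → ℂ) = Tower.component modularSpace m x := by
  induction x using Tower.induction with
  | h0 => simp
  | hof i a =>
    rw [incl_of, Tower.component_of, Tower.component_of]
  | hadd a b ha hb =>
    rw [map_add, map_add, map_add, Submodule.coe_add, ha, hb]; rfl

theorem G2_pow (i : ℕ) : ∃ h, G2 ^ i =
    Tower.of quasimodularSpace (2 * i) ⟨eisensteinG 2 ^ i, h⟩ := by
  induction i with
  | zero => exact ⟨SetLike.one_mem_graded quasimodularSpace, by rw [pow_zero, Tower.one_eq]; rfl⟩
  | succ i ih =>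
    obtain ⟨h, hi⟩ := ih
    refine ⟨?_, ?_⟩
    · rw [pow_succ]
      exact SetLike.mul_mem_graded h (⟨1, one_ne_zero, _, isQuasimodularWith_eisensteinG_two⟩ :
        eisensteinG 2 ∈ quasimodularSpace 2)
    · rw [pow_succ, hi, G2, Tower.of_mul_of]
      rfl

theorem evalG2_eq_sum (p : MTower[X]) :
    evalG2 p = ∑ i ∈ p.support, incl (p.coeff i) * G2 ^ i := by
  change eval₂ (incl : MTower →+* QMTower) G2 p = _
  rw [eval₂_eq_sum]; rfl

theorem evalG2_coe (p : MTower[X]) (k : ℕ) :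
    (Tower.component quasimodularSpace k (evalG2 p) : ℍ → ℂ) =
      ∑ i ∈ p.support, if 2 * i ≤ k then
        (Tower.component modularSpace (k - 2 * i) (p.coeff i) : ℍ → ℂ) * eisensteinG 2 ^ i
      else 0 := by
  rw [evalG2_eq_sum, map_sum, Submodule.coe_sum]
  refine Finset.sum_congr rfl fun i _ => ?_
  obtain ⟨hm, hi⟩ := G2_pow i
  rw [hi, Tower.component_mul_of]
  split_ifs
  · rw [coe_incl]
  · rfl

theorem common_level (s : Finset ℕ) (w : ℕ → ℤ) (a : ℕ → ℍ → ℂ) (ha : ∀ i, IsModular (w i) (a i)) :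
    ∃ N : ℕ, N ≠ 0 ∧ ∀ i ∈ s, ∀ γ ∈ Gamma N, a i ∣[w i] γ = a i := by
  choose N hN h using fun i => isModular_iff.mp (ha i)
  refine ⟨∏ i ∈ s, N i, Finset.prod_ne_zero_iff.mpr fun i _ => hN i, fun i hi γ hγ => ?_⟩
  exact (h i).2.1 γ (gamma_mono (Finset.dvd_prod_of_mem N hi) hγ)

theorem independent (s : Finset ℕ) (k : ℤ) (a : ℕ → ℍ → ℂ)
    (ha : ∀ i : ℕ, IsModular (k - 2 * (i : ℤ)) (a i)) (h : ∑ i ∈ s, a i * eisensteinG 2 ^ i = 0) :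
    ∀ i ∈ s, a i = 0 := by
  obtain ⟨N, hN, hinv⟩ := common_level s (fun i => k - 2 * (i : ℤ)) a ha
  intro i hi
  ext z
  set q : ℂ[X] := ∑ i ∈ s, monomial i (a i z) with hq
  have hq0 : q = 0 := by
    refine eq_of_infinite_eval_eq _ _ ((Set.infinite_range_of_injective (f := fun m : ℕ =>
      eisensteinG 2 z + g2const * cocyc (unip N m) z) ?_).mono ?_)
    · intro m m' hm
      exact cocyc_unip_injective hN z (mul_left_cancel₀ g2const_ne_zero (add_left_cancel hm))
    · rintro _ ⟨m, rfl⟩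
      have h1 : (∑ i ∈ s, a i * eisensteinG 2 ^ i) (unip N m • z) = 0 := by rw [h]; rfl
      have hj0 : denom (unip N m) z ≠ 0 := denom_ne_zero _ _
      set j : ℂ := denom (unip N m) z with hj
      have hg : eisensteinG 2 (unip N m • z) =
          j ^ (2 : ℤ) * (eisensteinG 2 z + g2const * cocyc (unip N m) z) := by
        have h2 := congrFun (eisensteinG_two_slash (unip N m)) z
        rw [ModularForm.SL_slash_apply, ← hj] at h2
        simp only [Pi.add_apply, Pi.smul_apply, smul_eq_mul] at h2
        rw [← h2, mul_comm, mul_assoc, ← zpow_add₀ hj0]; simp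
      have hai : ∀ i ∈ s, a i (unip N m • z) = j ^ (k - 2 * (i : ℤ)) * a i z := by
        intro i hi
        have h2 := congrFun (hinv i hi _ (unip_mem N m)) z
        rw [ModularForm.SL_slash_apply, ← hj] at h2
        rw [← h2, mul_comm, mul_assoc, ← zpow_add₀ hj0]; simp
      rw [Finset.sum_apply] at h1
      have h3 : j ^ k * ∑ i ∈ s, a i z * (eisensteinG 2 z + g2const * cocyc (unip N m) z) ^ i
          = 0 := by
        rw [Finset.mul_sum, ← h1]
        refine Finset.sum_congr rfl fun i hi => ?_
        rw [Pi.mul_apply, Pi.pow_apply, hai i hi, hg, mul_pow, zpow_sub₀ hj0,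
          zpow_mul j 2, zpow_natCast]
        have := pow_ne_zero i (zpow_ne_zero 2 hj0)
        field_simp
      have h4 := (mul_eq_zero.mp h3).resolve_left (zpow_ne_zero _ hj0)
      simp only [Set.mem_ofPred_eq, hq, eval_finsetSum, eval_monomial, eval_zero]
      exact h4
  have h5 : q.coeff i = a i z := by
    rw [hq, finsetSum_coeff]
    simp [coeff_monomial, hi]
  rw [← h5, hq0]; simp

theorem evalG2_injective : Function.Injective evalG2 := by
  rw [injective_iff_map_eq_zero]
  intro p hp
  refine Polynomial.ext fun i => ?_
  by_contra hi
  rw [coeff_zero] at hi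
  have hi' : i ∈ p.support := mem_support_iff.mpr hi
  refine hi ?_
  refine Tower.ext fun m => ?_
  have h := evalG2_coe p (m + 2 * i)
  rw [hp] at h
  have h2 := independent p.support ((m + 2 * i : ℕ) : ℤ)
    (fun j => if 2 * j ≤ m + 2 * i then (Tower.component modularSpace (m + 2 * i - 2 * j) (p.coeff j) : ℍ → ℂ) else 0)
    (fun j => ?_) ?_ i hi'
  · rw [if_pos (by omega), Nat.add_sub_cancel] at h2
    exact Subtype.ext h2
  · split_ifs with hj
    · have := (Tower.component modularSpace (m + 2 * i - 2 * j) (p.coeff j)).2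
      change IsModular ((m + 2 * i - 2 * j : ℕ) : ℤ) _ at this
      rw [Nat.cast_sub hj] at this
      exact_mod_cast this
    · exact isModular_zero _
  · simp only [ite_mul, zero_mul]
    exact h.symm

theorem of_mem_range_evalG2 {N : ℕ} (hN : N ≠ 0) (n : ℕ) : ∀ (k : ℕ) (f : ℍ → ℂ) (P : (ℍ → ℂ)[X]),
    P.degree < n → IsQuasimodularWith N k f P → ∀ hf : f ∈ quasimodularSpace k,
      Tower.of quasimodularSpace k ⟨f, hf⟩ ∈ evalG2.range := by
  have : NeZero N := ⟨hN⟩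
  induction n with
  | zero =>
    intro k f P hP h hf
    have hP0 : P = 0 := by
      rw [← degree_eq_bot]; simpa using hP
    have hf0 : f = 0 := by
      ext z
      have h1 := h.transf' 1 (one_mem _) z
      rw [SlashAction.slash_one, hP0, eval₂_zero] at h1
      exact h1
    have : (⟨f, hf⟩ : quasimodularSpace k) = 0 := Subtype.ext hf0
    rw [this, map_zero]
    exact zero_mem _
  | succ n ih =>
    intro k f P hP h hf
    have hn : P.natDegree ≤ n := natDegree_le_iff_coeff_eq_zero.mpr fun m hm =>
      (degree_lt_iff_coeff_zero P (n + 1)).mp hP m hm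
    set a := P.coeff n with ha
    have hmod : ∃ g : ModularForm ((Gamma N).map (Matrix.SpecialLinearGroup.mapGL ℝ))
        ((k : ℤ) - 2 * (n : ℤ)), ⇑g = a :=
      modularForm_iff.mpr ⟨h.coeff_holo n, h.top_slash hN hn, h.coeff_bdd n⟩
    by_cases hk : k < 2 * n
    · refine ih k f P ?_ h hf
      have ha0 : a = 0 := by
        obtain ⟨g, hg⟩ := hmod
        rw [← hg, ModularForm.isZero_of_neg_weight (by omega) g]; rfl
      rw [degree_lt_iff_coeff_zero]
      intro m hm
      rcases hm.eq_or_lt with rfl | hm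
      · exact ha0
      · exact coeff_eq_zero_of_natDegree_lt (lt_of_le_of_lt hn hm)
    · obtain ⟨m, rfl⟩ : ∃ m, k = m + 2 * n := ⟨k - 2 * n, by omega⟩
      have hm : (((m + 2 * n : ℕ) : ℤ) - 2 * (n : ℤ)) = m := by push_cast; ring
      rw [hm] at hmod
      have hb : ∃ g : ModularForm ((Gamma N).map (Matrix.SpecialLinearGroup.mapGL ℝ)) (m : ℤ),
          ⇑g = (g2const ^ n)⁻¹ • a := by
        obtain ⟨g, hg⟩ := hmod
        exact ⟨(g2const ^ n)⁻¹ • g, by rw [← hg]; rfl⟩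
      set b : ℍ → ℂ := (g2const ^ n)⁻¹ • a with hbdef
      have hbM : b ∈ modularSpace m := ⟨N, hN, hb⟩
      obtain ⟨hgm, hg⟩ := G2_pow n
      have hprod : Tower.of quasimodularSpace (m + 2 * n)
          ⟨b * eisensteinG 2 ^ n, SetLike.mul_mem_graded (modularSpace_le m hbM) hgm⟩ =
          evalG2 (monomial n (Tower.of modularSpace m ⟨b, hbM⟩)) := by
        have e1 : evalG2 (monomial n (Tower.of modularSpace m ⟨b, hbM⟩)) =
            incl (Tower.of modularSpace m ⟨b, hbM⟩) * G2 ^ n := by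
          change eval₂ (incl : MTower →+* QMTower) G2 _ = _
          rw [eval₂_monomial]; rfl
        have e2 : incl (Tower.of modularSpace m ⟨b, hbM⟩) =
            Tower.of quasimodularSpace m ⟨b, modularSpace_le m hbM⟩ := by
          exact incl_of _ _
        rw [e1, e2, hg, Tower.of_mul_of]
      set R : (ℍ → ℂ)[X] := C b * (C (eisensteinG 2) + C (fun _ => g2const) * X) ^ n with hR
      have hpow : ∀ i : ℕ, IsQuasimodularWith N (2 * (i : ℤ)) (eisensteinG 2 ^ i)
          ((C (eisensteinG 2) + C (fun _ => g2const) * X) ^ i) := by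
        intro i
        induction i with
        | zero =>
          have := isQuasimodularWith_C (N := N) (k := 0) (f := 1) ⟨1, rfl⟩
          simpa using! this
        | succ i ih =>
          have := ih.mul (isQuasimodularWith_eisensteinG_two.mono (one_dvd N))
          rw [pow_succ, pow_succ]
          convert! this using 1
      have hRq : IsQuasimodularWith N ((m + 2 * n : ℕ) : ℤ) (b * eisensteinG 2 ^ n) R := by
        have := (isQuasimodularWith_C hb).mul (hpow n)
        push_cast
        exact this
      have hlin : (C (eisensteinG 2) + C (fun _ : ℍ => g2const) * X).natDegree ≤ 1 := by
        rw [add_comm]; exact natDegree_linear_le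
      have hRn : R.coeff n = a := by
        have := coeff_pow_of_natDegree_le (m := n) hlin
        rw [mul_one] at this
        rw [hR, coeff_C_mul, this]
        ext z
        have h1 : (C (eisensteinG 2) + C (fun _ : ℍ => g2const) * X).coeff 1 =
          fun _ => g2const := by simp [coeff_C]
        rw [h1, Pi.mul_apply, Pi.pow_apply, hbdef, Pi.smul_apply, smul_eq_mul]
        have := pow_ne_zero n g2const_ne_zero
        field_simp
      have hRd : R.natDegree ≤ n :=
        (natDegree_C_mul_le _ _).trans ((natDegree_pow_le_of_le n hlin).trans (by simp))
      have hsub : IsQuasimodularWith N ((m + 2 * n : ℕ) : ℤ)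
          (f + (-1 : ℂ) • (b * eisensteinG 2 ^ n)) (P + (-1 : ℂ) • R) := h.add (hRq.smul _)
      have hmem : f + (-1 : ℂ) • (b * eisensteinG 2 ^ n) ∈ quasimodularSpace (m + 2 * n) :=
        ⟨N, hN, _, hsub⟩
      have h1 := ih _ _ _ (by
        rw [degree_lt_iff_coeff_zero]
        intro i hi
        rw [coeff_add, coeff_smul]
        rcases hi.eq_or_lt with rfl | hi
        · rw [hRn]; simp [ha]
        · rw [coeff_eq_zero_of_natDegree_lt (lt_of_le_of_lt hn hi),
            coeff_eq_zero_of_natDegree_lt (lt_of_le_of_lt hRd hi)]; simp) hsub hmem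
      have h2 := add_mem h1 (AlgHom.mem_range_self evalG2
        (monomial n (Tower.of modularSpace m ⟨b, hbM⟩)))
      rw [← hprod, ← map_add] at h2
      convert! h2 using 3
      ext z
      simp

theorem evalG2_surjective : Function.Surjective evalG2 := by
  intro x
  change x ∈ evalG2.range
  induction x using Tower.induction with
  | h0 => exact zero_mem _
  | hof k f =>
    obtain ⟨f, hf⟩ := f
    obtain ⟨N, hN, P, hP⟩ := id hf
    refine of_mem_range_evalG2 hN (P.natDegree + 1) k f P ?_ hP hf
    exact lt_of_le_of_lt degree_le_natDegree (by exact_mod_cast Nat.lt_succ_self _)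
  | hadd a b ha hb => exact add_mem ha hb

/-- The expansion `f = ∑ i, a_i(f) G_2^i` of quasimodular forms with modular coefficients: the
inverse of the evaluation of polynomials at `G_2`. -/
noncomputable def expansion : QMTower ≃ₐ[ℂ] MTower[X] :=
  (AlgEquiv.ofBijective evalG2 ⟨evalG2_injective, evalG2_surjective⟩).symm

/-! ### The action of `GL_2^+(ℚ)` -/

/-- A rational matrix as a real matrix. -/
noncomputable def toReal (α : GL(2, ℚ)⁺) : GL (Fin 2) ℝ :=
  Matrix.GeneralLinearGroup.map (Rat.castHom ℝ) (α : GL (Fin 2) ℚ)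

theorem toReal_det_pos (α : GL(2, ℚ)⁺) : 0 < (toReal α).det.val := by
  have h : (toReal α).det.val = ((α : GL (Fin 2) ℚ).det.val : ℝ) :=
    congrArg Units.val (Matrix.GeneralLinearGroup.map_det (Rat.castHom ℝ) (α : GL (Fin 2) ℚ))
  rw [h]
  exact_mod_cast α.2

/-- `(f|_k α)(z) = (cz+d)^(-k) f((az+b)/(cz+d))`, without a determinant factor. -/
noncomputable def slashQ (k : ℤ) (α : GL(2, ℚ)⁺) (f : ℍ → ℂ) (z : ℍ) : ℂ :=
  denom (toReal α) z ^ (-k) * f (toReal α • z)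

theorem slashQ_eq (k : ℤ) (α : GL(2, ℚ)⁺) (f : ℍ → ℂ) :
    slashQ k α f = (((toReal α).det.val : ℂ) ^ (k - 1))⁻¹ • (f ∣[k] toReal α) := by
  ext z
  have h0 := toReal_det_pos α
  have hσ : σ (toReal α) = .refl ℝ ℂ := by rw [σ, if_pos h0]
  have h1 : (((toReal α).det.val : ℂ) ^ (k - 1)) ≠ 0 :=
    zpow_ne_zero _ (by exact_mod_cast h0.ne')
  rw [Pi.smul_apply, ModularForm.slash_apply, hσ, abs_of_pos h0, slashQ, smul_eq_mul]
  change _ = _ * (f (toReal α • z) * _ * _)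
  field_simp

open ConjAct Pointwise in
theorem IsModular.slashQ {k : ℤ} {f : ℍ → ℂ} (hf : IsModular k f) (α : GL(2, ℚ)⁺) :
    IsModular k (slashQ k α f) := by
  rw [slashQ_eq]
  refine IsModular.smul _ ?_
  obtain ⟨M, hM, g, rfl⟩ := hf
  have : NeZero M := ⟨hM⟩
  obtain ⟨N, hN, h⟩ := exists_Gamma_le_conj' (α : GL (Fin 2) ℚ) M
  have : NeZero N := ⟨hN⟩
  change toConjAct (toReal α) • _ ≤ _ at h
  have hle : (Gamma N).map (Matrix.SpecialLinearGroup.mapGL ℝ) ≤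
      toConjAct (toReal α)⁻¹ • (Gamma M).map (Matrix.SpecialLinearGroup.mapGL ℝ) := by
    rw [map_inv, ← Subgroup.pointwise_smul_subset_iff]; exact h
  set t := ModularForm.translate g (toReal α) with ht
  have e : ⇑g ∣[k] toReal α = ⇑t := rfl
  refine ⟨N, hN, ⟨⟨⇑t, fun γ hγ => t.slash_action_eq' γ (hle hγ)⟩, t.holo', ?_⟩, rfl⟩
  intro c hc
  exact t.bdd_at_cusps' (hc.mono hle)

theorem slashQ_mul (k l : ℤ) (α : GL(2, ℚ)⁺) (f g : ℍ → ℂ) :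
    slashQ (k + l) α (f * g) = slashQ k α f * slashQ l α g := by
  ext z
  rw [Pi.mul_apply, slashQ, slashQ, slashQ, neg_add, zpow_add₀ (denom_ne_zero _ z), Pi.mul_apply]
  ring

/-- The operation `f ↦ f|_k α` on modular forms of weight `k` and arbitrary level. -/
noncomputable def slashLin (α : GL(2, ℚ)⁺) (k : ℕ) : modularSpace k →ₗ[ℂ] modularSpace k where
  toFun f := ⟨slashQ k α f, IsModular.slashQ f.2 α⟩
  map_add' _ _ := Subtype.ext <| funext fun _ => mul_add _ _ _
  map_smul' _ _ := Subtype.ext <| funext fun _ => mul_left_comm _ _ _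

/-- The operation `f ↦ f|α` on the modular tower, equal to `f ↦ f|_k α` in weight `k`. -/
noncomputable def mSlash (α : GL(2, ℚ)⁺) : MTower →ₐ[ℂ] MTower :=
  Tower.map (slashLin α)
    (by ext z; simp [slashLin, slashQ])
    (by
      intro i j a b
      change slashQ ((i + j : ℕ) : ℤ) α _ = slashQ i α a * slashQ j α b
      rw [Nat.cast_add, slashQ_mul])

theorem mSlash_of (α : GL(2, ℚ)⁺) (k : ℕ) (f : modularSpace k) :
    mSlash α (Tower.of modularSpace k f) = Tower.of modularSpace k (slashLin α k f) :=
  Tower.map_of _ _ _ k f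

/-- The operation `f || α = ∑ i, (a_i(f)|α) G_2^i` on the quasimodular tower, where
`f = ∑ i, a_i(f) G_2^i` with modular coefficients. -/
noncomputable def dslash (α : GL(2, ℚ)⁺) : QMTower →ₐ[ℂ] QMTower :=
  evalG2.comp ((Polynomial.mapAlgHom (mSlash α)).comp expansion.toAlgHom)

theorem evalG2_expansion (f : QMTower) : evalG2 (expansion f) = f :=
  (AlgEquiv.ofBijective evalG2 ⟨evalG2_injective, evalG2_surjective⟩).apply_symm_apply f

theorem evalG2_X : evalG2 X = G2 := by
  change eval₂ (incl : MTower →+* QMTower) G2 _ = _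
  rw [eval₂_X]

theorem evalG2_C (a : MTower) : evalG2 (C a) = incl a := by
  change eval₂ (incl : MTower →+* QMTower) G2 _ = _
  rw [eval₂_C]; rfl

/-- The modular coefficients of an element of the quasimodular tower in its expansion. -/
noncomputable def coef (i : ℕ) (f : QMTower) : MTower := (expansion f).coeff i

theorem eq_sum_coef (f : QMTower) :
    f = ∑ i ∈ (expansion f).support, incl (coef i f) * G2 ^ i := by
  conv_lhs => rw [← evalG2_expansion f]
  exact evalG2_eq_sum _

theorem dslash_eq_sum (α : GL(2, ℚ)⁺) (f : QMTower) :
    dslash α f = ∑ i ∈ (expansion f).support, incl (mSlash α (coef i f)) * G2 ^ i := by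
  change evalG2 ((expansion f).map (mSlash α : MTower →+* MTower)) = _
  conv_lhs => rw [(expansion f).as_sum_support_C_mul_X_pow]
  rw [Polynomial.map_sum, map_sum]
  refine Finset.sum_congr rfl fun i _ => ?_
  rw [Polynomial.map_mul, Polynomial.map_pow, map_C, map_X, map_mul, map_pow, evalG2_C, evalG2_X]
  rfl

/-! ### The operators -/

/-- The derivation `∑ i, a_i G_2^i ↦ ∑ i, i a_i G_2^(i-1)`. -/
noncomputable def dG2 : QMTower →ₗ[ℂ] QMTower :=
  evalG2.toLinearMap ∘ₗ (Polynomial.derivative.restrictScalars ℂ) ∘ₗ expansion.toLinearMap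

/-- `D(f) = -1/(8πi) ∑ i, i a_i(f) G_2^(i-1) G_2'`. -/
noncomputable def opD : QMTower →ₗ[ℂ] QMTower :=
  (-(1 / (8 * Real.pi * Complex.I)) : ℂ) • LinearMap.mulRight ℂ G2' ∘ₗ dG2

/-- `W_k(f) = ∑ i, i a_i(f) G_2^(i+k-2)` for `k ≥ 1`. -/
noncomputable def opW (k : ℕ+) : QMTower →ₗ[ℂ] QMTower :=
  LinearMap.mulLeft ℂ (G2 ^ ((k : ℕ) - 1)) ∘ₗ dG2

theorem dG2_eq_sum (f : QMTower) :
    dG2 f = ∑ i ∈ (expansion f).support, (i : ℂ) • (incl (coef i f) * G2 ^ (i - 1)) := by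
  change evalG2 (derivative (expansion f)) = _
  rw [derivative_apply, Polynomial.sum, map_sum]
  refine Finset.sum_congr rfl fun i _ => ?_
  rw [map_mul, map_pow, evalG2_C, evalG2_X, map_mul, map_natCast, coef, Nat.cast_smul_eq_nsmul,
    nsmul_eq_mul]
  ring

theorem opD_eq_sum (f : QMTower) : opD f = (-(1 / (8 * Real.pi * Complex.I)) : ℂ) •
    ∑ i ∈ (expansion f).support, (i : ℂ) • (incl (coef i f) * G2 ^ (i - 1) * G2') := by
  change (-(1 / (8 * Real.pi * Complex.I)) : ℂ) • (dG2 f * G2') = _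
  rw [dG2_eq_sum, Finset.sum_mul]
  simp_rw [smul_mul_assoc]

theorem opW_eq_sum (k : ℕ+) (f : QMTower) : opW k f =
    ∑ i ∈ (expansion f).support, (i : ℂ) • (incl (coef i f) * G2 ^ (i + (k : ℕ) - 2)) := by
  change _ * dG2 f = _
  rw [dG2_eq_sum, Finset.mul_sum]
  refine Finset.sum_congr rfl fun i _ => ?_
  rcases Nat.eq_zero_or_pos i with rfl | hi
  · simp
  · have hk := k.pos
    rw [mul_smul_comm, mul_left_comm, ← pow_add]
    congr 4
    omega

/-- `E(f) = G_4 f`. -/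
noncomputable def opE : QMTower →ₗ[ℂ] QMTower := LinearMap.mulLeft ℂ (incl G4)

/-- `T_k^l = E^l W_k`. -/
noncomputable def opT (k : ℕ+) (l : ℕ) : QMTower →ₗ[ℂ] QMTower := opE ^ l * opW k

/-- `ν_α^(m) = -5/24 (G_4^m|α - G_4^m)`. -/
noncomputable def nu (m : ℕ+) (α : GL(2, ℚ)⁺) : MTower :=
  (-(5 / 24) : ℂ) • (mSlash α (G4 ^ (m : ℕ)) - G4 ^ (m : ℕ))

/-! ### Quasimodular Hecke operators -/

/-- `SL_2(ℤ)` inside `GL_2^+(ℚ)`. -/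
def toQ : SL(2, ℤ) →* GL(2, ℚ)⁺ :=
  Matrix.SpecialLinearGroup.toGLPos.comp (Matrix.SpecialLinearGroup.map (Int.castRingHom ℚ))

/-- `Γ(N)` as a subgroup of `GL_2^+(ℚ)`. -/
def GammaQ (N : ℕ) : Subgroup GL(2, ℚ)⁺ := (Gamma N).map toQ

/-- The quasimodular Hecke operators of level `Γ = Γ(N)`: functions `F` on `Γ \ GL_2^+(ℚ)` with
finite support, values in the quasimodular tower, and `F_{αγ} = F_α || γ` for `γ` in `Γ`. -/
def Q (N : ℕ) : Submodule ℂ (GL(2, ℚ)⁺ → QMTower) where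
  carrier := {F | (∀ γ ∈ GammaQ N, ∀ α, F (γ * α) = F α) ∧
    (Quotient.mk (QuotientGroup.rightRel (GammaQ N)) '' Function.support F).Finite ∧
    ∀ γ ∈ GammaQ N, ∀ α, F (α * γ) = dslash γ (F α)}
  add_mem' := by
    rintro F G ⟨h1, h2, h3⟩ ⟨h1', h2', h3'⟩
    refine ⟨fun γ hγ α => ?_, ?_, fun γ hγ α => ?_⟩
    · rw [Pi.add_apply, Pi.add_apply, h1 γ hγ, h1' γ hγ]
    · refine (h2.union h2').subset ?_
      rw [← Set.image_union]
      exact Set.image_mono (Function.support_add F G)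
    · rw [Pi.add_apply, Pi.add_apply, h3 γ hγ, h3' γ hγ, map_add]
  zero_mem' := by
    refine ⟨fun _ _ _ => rfl, ?_, fun γ _ _ => (map_zero (dslash γ)).symm⟩
    rw [Function.support_zero, Set.image_empty]
    exact Set.finite_empty
  smul_mem' := by
    rintro c F ⟨h1, h2, h3⟩
    refine ⟨fun γ hγ α => ?_, h2.subset (Set.image_mono (Function.support_const_smul_subset c F)),
      fun γ hγ α => ?_⟩
    · rw [Pi.smul_apply, Pi.smul_apply, h1 γ hγ]
    · rw [Pi.smul_apply, Pi.smul_apply, h3 γ hγ, map_smul]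

/-- The product `(F ∗ʳ G)_α = ∑ β ∈ Γ \ SL_2(ℤ), F_β (G_{αβ⁻¹} || β)` of level `Γ = Γ(N)`. For
`F`, `G` in `Q N` the summand does not depend on the representative of the coset of `β`. -/
noncomputable def starR (N : ℕ) (F G : GL(2, ℚ)⁺ → QMTower) (α : GL(2, ℚ)⁺) : QMTower :=
  ∑ᶠ q : Quotient (QuotientGroup.rightRel (Gamma N)),
    F (toQ q.out) * dslash (toQ q.out) (G (α * (toQ q.out)⁻¹))

end QuasimodularHecke

open QuasimodularHecke
open scoped MatrixGroups TensorProduct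

/-!
By Ramanujan's identity `G_2'` is a multiple of `-2 G_2 ^ 2 + 5/6 G_4`, so `D` is the derivation
`1/2 T_3^0 - 5/24 T_1^1`. Hence `D` and all `T_k^l = G_4^l G_2^(k-1) d/dG_2` are derivations of the
quasimodular tower commuting with `SL(2, ℤ)`; they act on the terms of `∗ʳ` by the Leibniz rule, and
their brackets are those of polynomial vector fields. The operator `φ^(m)` multiplies by the
coboundary `α ↦ g || α - g` of a form `g` of level one; as this vanishes on `SL(2, ℤ)`, its cocycle
rule is the Leibniz rule for the terms of `∗ʳ`. So every generator acts by a derivation, and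
derivations form a Lie algebra, which gives an action of `L` by derivations. The Hopf identity says
that the product intertwines the actions of `H` on `Q ⊗ Q` and `Q`. Both are algebra homomorphisms,
so it suffices that it holds on `L`, where it is the Leibniz rule.
-/

namespace QuasimodularHecke

open UpperHalfPlane CongruenceSubgroup
open scoped MatrixGroups ModularForm Manifold DirectSum TensorProduct

/-! ### Derivations, enveloping algebras and right cosets -/

section LieAlgebra

attribute [local instance 100] LieRing.ofAssociativeRing

/-- The Lie algebra of derivations of the nonassociative algebra whose product is the bilinear
map `μ`. -/
def derivations {R A : Type*} [CommRing R] [AddCommGroup A] [Module R A]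
    (μ : A →ₗ[R] A →ₗ[R] A) : LieSubalgebra R (Module.End R A) where
  carrier := {d | ∀ x y, d (μ x y) = μ (d x) y + μ x (d y)}
  add_mem' hd he x y := by
    simp only [LinearMap.add_apply, hd x y, he x y, map_add]
    abel
  zero_mem' x y := by simp only [LinearMap.zero_apply, map_zero, add_zero]
  smul_mem' c d hd x y := by
    simp only [LinearMap.smul_apply, hd x y, map_smul, smul_add]
  lie_mem' {d e} hd he x y := by
    simp only [LieRing.of_associative_ring_bracket, LinearMap.sub_apply, Module.End.mul_apply,
      hd _ _, he _ _, map_add, map_sub]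
    abel

theorem mem_derivations {R A : Type*} [CommRing R] [AddCommGroup A] [Module R A]
    {μ : A →ₗ[R] A →ₗ[R] A} {d : Module.End R A} :
    d ∈ derivations μ ↔ ∀ x y, d (μ x y) = μ (d x) y + μ x (d y) := Iff.rfl

/-- The homomorphism on the quotient by a Lie ideal induced by a homomorphism that vanishes on the
ideal. -/
def lieQuotientLift {R 𝔤 𝔤' : Type*} [CommRing R] [LieRing 𝔤] [LieAlgebra R 𝔤] [LieRing 𝔤']
    [LieAlgebra R 𝔤'] (I : LieIdeal R 𝔤) (f : 𝔤 →ₗ⁅R⁆ 𝔤') (hf : I ≤ f.ker) : 𝔤 ⧸ I →ₗ⁅R⁆ 𝔤' where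
  toLinearMap := I.toSubmodule.liftQ f.toLinearMap fun _ hx => LieHom.mem_ker.mp (hf hx)
  map_lie' {x y} := by
    obtain ⟨x, rfl⟩ := LieSubmodule.Quotient.surjective_mk' I x
    obtain ⟨y, rfl⟩ := LieSubmodule.Quotient.surjective_mk' I y
    exact f.map_lie x y

section Enveloping

variable {𝔤 : Type} [LieRing 𝔤] [LieAlgebra ℂ 𝔤] {A : Type*} [AddCommGroup A] [Module ℂ A]

/-- The action on `A ⊗ A` through the coproduct of the enveloping algebra. -/
noncomputable def tensorSquareAction (ρ : UniversalEnvelopingAlgebra ℂ 𝔤 →ₐ[ℂ] Module.End ℂ A) :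
    UniversalEnvelopingAlgebra ℂ 𝔤 →ₐ[ℂ] Module.End ℂ (A ⊗[ℂ] A) :=
  Module.endTensorEndAlgHom.comp ((Algebra.TensorProduct.map ρ ρ).comp (envComul 𝔤))

theorem tensorSquareAction_apply_tmul {ι : Type*}
    (ρ : UniversalEnvelopingAlgebra ℂ 𝔤 →ₐ[ℂ] Module.End ℂ A)
    {h : UniversalEnvelopingAlgebra ℂ 𝔤} (r : Coalgebra.Repr ℂ h ι) (x y : A) :
    tensorSquareAction ρ h (x ⊗ₜ y) =
      ∑ i ∈ r.index, ρ (r.left i) x ⊗ₜ[ℂ] ρ (r.right i) y := by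
  have hr : envComul 𝔤 h = ∑ i ∈ r.index, r.left i ⊗ₜ r.right i := r.eq.symm
  simp only [tensorSquareAction, AlgHom.comp_apply, hr, map_sum, LinearMap.sum_apply,
    Algebra.TensorProduct.map_tmul, Module.endTensorEndAlgHom_apply,
    TensorProduct.AlgebraTensorModule.map_tmul]

theorem apply_lift_eq_lift_tensorSquareAction {μ : A →ₗ[ℂ] A →ₗ[ℂ] A}
    {ρ : UniversalEnvelopingAlgebra ℂ 𝔤 →ₐ[ℂ] Module.End ℂ A}
    (hρ : ∀ x, ρ (UniversalEnvelopingAlgebra.ι ℂ x) ∈ derivations μ)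
    (h : UniversalEnvelopingAlgebra ℂ 𝔤) (t : A ⊗[ℂ] A) :
    ρ h (TensorProduct.lift μ t) = TensorProduct.lift μ (tensorSquareAction ρ h t) := by
  induction h using env_induction 𝔤 generalizing t with
  | hι x =>
    induction t using TensorProduct.induction_on with
    | zero => simp only [map_zero]
    | tmul a b =>
      rw [TensorProduct.lift.tmul, mem_derivations.mp (hρ x)]
      simp [tensorSquareAction, envComul_ι, Module.endTensorEndAlgHom_apply,
        -UniversalEnvelopingAlgebra.ι_apply]
    | add a b ha hb => simp only [map_add, ha, hb]
  | hc c => simp only [AlgHom.commutes, Module.algebraMap_end_apply, map_smul]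
  | hadd a b ha hb => simp only [map_add, LinearMap.add_apply, ha, hb]
  | hmul a b ha hb => simp only [map_mul, Module.End.mul_apply, ha, hb]

theorem apply_eq_sum_of_ι_mem_derivations {μ : A →ₗ[ℂ] A →ₗ[ℂ] A}
    {ρ : UniversalEnvelopingAlgebra ℂ 𝔤 →ₐ[ℂ] Module.End ℂ A}
    (hρ : ∀ x, ρ (UniversalEnvelopingAlgebra.ι ℂ x) ∈ derivations μ) {ι : Type*}
    {h : UniversalEnvelopingAlgebra ℂ 𝔤} (r : Coalgebra.Repr ℂ h ι) (x y : A) :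
    ρ h (μ x y) = ∑ i ∈ r.index, μ (ρ (r.left i) x) (ρ (r.right i) y) := by
  rw [← TensorProduct.lift.tmul, apply_lift_eq_lift_tensorSquareAction hρ,
    tensorSquareAction_apply_tmul ρ r, map_sum]
  rfl

end Enveloping

end LieAlgebra

section Derivation
variable {R A : Type*} [CommRing R] [CommRing A] [Algebra R A]

theorem lie_smul_smul_derivation (δ : Derivation R A A) (a b : A) :
    ⁅a • δ, b • δ⁆ = (a * δ b - b * δ a) • δ := by
  ext x
  simp only [Derivation.commutator_apply, Derivation.smul_apply, smul_eq_mul, Derivation.leibniz]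
  ring

theorem lie_pow_mul_pow_smul_derivation {δ : Derivation R A A} {x y : A} (hx : δ x = 1)
    (hy : δ y = 0) (l l' m n : ℕ) :
    ⁅(y ^ l * x ^ m) • δ, (y ^ l' * x ^ n) • δ⁆ =
      ((n : R) - m) • (y ^ (l + l') * x ^ (m + n - 1)) • δ := by
  have hδ (a b i j : ℕ) :
      y ^ a * x ^ i * δ (y ^ b * x ^ j) = (j : R) • (y ^ (a + b) * x ^ (i + j - 1)) := by
    rw [δ.leibniz, δ.leibniz_pow, δ.leibniz_pow, hx, hy]
    cases j with
    | zero => simp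
    | succ j =>
      rw [← Nat.add_assoc, Nat.add_sub_cancel, Nat.add_sub_cancel]
      simp only [nsmul_eq_mul, smul_eq_mul, Nat.cast_smul_eq_nsmul, pow_add]
      ring
  rw [lie_smul_smul_derivation, hδ, hδ, add_comm l', add_comm n, ← sub_smul, smul_assoc]

end Derivation

section RightCosets

variable {K : Type*} [Group K] {Γ : Subgroup K}

/-- Right multiplication on the set of right cosets. -/
def rightCosetsMulRight (Γ : Subgroup K) (δ : K) :
    Quotient (QuotientGroup.rightRel Γ) ≃ Quotient (QuotientGroup.rightRel Γ) :=
  Quotient.congr (Equiv.mulRight δ) fun a b => by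
    simp [QuotientGroup.rightRel_apply, mul_assoc]

theorem rightCosetsMulRight_mk (δ a : K) :
    rightCosetsMulRight Γ δ (Quotient.mk _ a) = Quotient.mk _ (a * δ) := rfl

theorem apply_out_rightCosetsMulRight {M : Type*} {φ : K → M}
    (hφ : ∀ γ ∈ Γ, ∀ β, φ (γ * β) = φ β) (δ : K) (q : Quotient (QuotientGroup.rightRel Γ)) :
    φ (rightCosetsMulRight Γ δ q).out = φ (q.out * δ) := by
  have h : QuotientGroup.rightRel Γ (rightCosetsMulRight Γ δ q).out (q.out * δ) := by
    rw [← Quotient.eq, Quotient.out_eq, ← rightCosetsMulRight_mk, Quotient.out_eq]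
  rw [QuotientGroup.rightRel_apply] at h
  rw [← hφ _ h, inv_mul_cancel_right]

theorem sum_out_mul_right [Fintype (Quotient (QuotientGroup.rightRel Γ))] {M : Type*}
    [AddCommMonoid M] {φ : K → M} (hφ : ∀ γ ∈ Γ, ∀ β, φ (γ * β) = φ β) (δ : K) :
    ∑ q : Quotient (QuotientGroup.rightRel Γ), φ (q.out * δ) =
      ∑ q : Quotient (QuotientGroup.rightRel Γ), φ q.out :=
  Fintype.sum_equiv (rightCosetsMulRight Γ δ) _ _ fun q =>
    (apply_out_rightCosetsMulRight hφ δ q).symm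

theorem finite_rightCosets_image_mul_right {s : Set K}
    (hs : (Quotient.mk (QuotientGroup.rightRel Γ) '' s).Finite) (δ : K) :
    (Quotient.mk (QuotientGroup.rightRel Γ) '' ((· * δ) '' s)).Finite := by
  rw [Set.image_image]
  simpa only [Set.image_image, rightCosetsMulRight_mk] using hs.image (rightCosetsMulRight Γ δ)

end RightCosets

/-! ### The action of `GL₂⁺(ℚ)` and the derivation `d/dG₂` -/

section Tower

open Polynomial

theorem toReal_mul (α β : GL(2, ℚ)⁺) : toReal (α * β) = toReal α * toReal β :=
  map_mul (Matrix.GeneralLinearGroup.map (Rat.castHom ℝ)) _ _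

theorem slashQ_mul_left (k : ℤ) (α β : GL(2, ℚ)⁺) (f : ℍ → ℂ) :
    slashQ k (α * β) f = slashQ k β (slashQ k α f) := by
  ext z
  have hσ : σ (toReal β) = .refl ℝ ℂ := by rw [σ, if_pos (toReal_det_pos β)]
  rw [slashQ, slashQ, slashQ, toReal_mul, mul_smul, denom_cocycle_σ, hσ,
    ContinuousAlgEquiv.refl_apply, mul_zpow]
  ring

theorem toReal_toQ (γ : SL(2, ℤ)) : toReal (toQ γ) = Matrix.SpecialLinearGroup.mapGL ℝ γ := by
  ext i j
  simp [toReal, toQ]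

theorem slashQ_toQ (k : ℤ) (γ : SL(2, ℤ)) (f : ℍ → ℂ) : slashQ k (toQ γ) f = f ∣[k] γ := by
  ext z
  rw [slashQ, toReal_toQ, ModularForm.SL_slash_apply, mul_comm]
  rfl

theorem mSlash_mul (α β : GL(2, ℚ)⁺) (f : MTower) :
    mSlash (α * β) f = mSlash β (mSlash α f) := by
  induction f using Tower.induction with
  | h0 => simp only [map_zero]
  | hof k a =>
    rw [mSlash_of, mSlash_of, mSlash_of]
    exact congrArg (Tower.of modularSpace k) (Subtype.ext (slashQ_mul_left k α β a))
  | hadd a b ha hb => simp only [map_add, ha, hb]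

theorem eisensteinG_four_slash (γ : SL(2, ℤ)) : eisensteinG 4 ∣[(4 : ℤ)] γ = eisensteinG 4 := by
  rw [eisensteinG_four, ModularForm.SL_smul_slash]
  exact congrArg _ (ModularForm.E₄.slash_action_eq' _ ⟨γ, rfl⟩)

theorem mSlash_toQ_G4 (γ : SL(2, ℤ)) : mSlash (toQ γ) G4 = G4 := by
  rw [G4, mSlash_of]
  exact congrArg (Tower.of modularSpace 4)
    (Subtype.ext ((slashQ_toQ 4 γ _).trans (eisensteinG_four_slash γ)))

theorem expansion_evalG2 (p : MTower[X]) : expansion (evalG2 p) = p :=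
  (AlgEquiv.ofBijective evalG2 ⟨evalG2_injective, evalG2_surjective⟩).symm_apply_apply p

theorem dslash_evalG2 (α : GL(2, ℚ)⁺) (p : MTower[X]) :
    dslash α (evalG2 p) = evalG2 (p.map (mSlash α : MTower →+* MTower)) := by
  conv_rhs => rw [← expansion_evalG2 p]
  rfl

theorem dslash_mul (α β : GL(2, ℚ)⁺) (f : QMTower) :
    dslash (α * β) f = dslash β (dslash α f) := by
  obtain ⟨p, rfl⟩ := evalG2_surjective f
  rw [dslash_evalG2, dslash_evalG2, dslash_evalG2, Polynomial.map_map]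
  congr 2
  exact RingHom.ext (mSlash_mul α β)

theorem dslash_incl (α : GL(2, ℚ)⁺) (a : MTower) : dslash α (incl a) = incl (mSlash α a) := by
  rw [← evalG2_C, dslash_evalG2, map_C, evalG2_C]
  rfl

theorem dslash_G2 (α : GL(2, ℚ)⁺) : dslash α G2 = G2 := by
  rw [← evalG2_X, dslash_evalG2, map_X]

theorem dG2_evalG2 (p : MTower[X]) : dG2 (evalG2 p) = evalG2 (derivative p) := by
  conv_rhs => rw [← expansion_evalG2 p]
  rfl

theorem dG2_mul (f g : QMTower) : dG2 (f * g) = f • dG2 g + g • dG2 f := by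
  obtain ⟨p, rfl⟩ := evalG2_surjective f
  obtain ⟨q, rfl⟩ := evalG2_surjective g
  simp only [← map_mul, dG2_evalG2, derivative_mul, map_add, smul_eq_mul]
  ring_nf

/-- The linear map `dG2` as a derivation. -/
noncomputable def dG2Derivation : Derivation ℂ QMTower QMTower := Derivation.mk' dG2 dG2_mul

theorem dG2Derivation_apply (f : QMTower) : dG2Derivation f = dG2 f := rfl

theorem dG2Derivation_incl (a : MTower) : dG2Derivation (incl a) = 0 := by
  rw [dG2Derivation_apply, ← evalG2_C, dG2_evalG2, derivative_C, map_zero]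

theorem dG2Derivation_G2 : dG2Derivation G2 = 1 := by
  rw [dG2Derivation_apply, ← evalG2_X, dG2_evalG2, derivative_X, map_one]

theorem dG2Derivation_dslash (α : GL(2, ℚ)⁺) (f : QMTower) :
    dG2Derivation (dslash α f) = dslash α (dG2Derivation f) := by
  obtain ⟨p, rfl⟩ := evalG2_surjective f
  simp only [dG2Derivation_apply, dslash_evalG2, dG2_evalG2, derivative_map]

end Tower

/-! ### The product and its derivations -/

section LevelOne

/-- The quasimodular forms that are invariant under `SL(2, ℤ)`. -/
noncomputable def levelOne : Subalgebra ℂ QMTower :=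
  ⨅ γ : SL(2, ℤ), AlgHom.equalizer (dslash (toQ γ)) (AlgHom.id ℂ QMTower)

theorem mem_levelOne {f : QMTower} : f ∈ levelOne ↔ ∀ γ, dslash (toQ γ) f = f := by
  simp only [levelOne, Algebra.mem_iInf, AlgHom.mem_equalizer, AlgHom.id_apply]

theorem G2_mem_levelOne : G2 ∈ levelOne := mem_levelOne.mpr fun _ => dslash_G2 _

theorem incl_G4_mem_levelOne : incl G4 ∈ levelOne :=
  mem_levelOne.mpr fun γ => by rw [dslash_incl, mSlash_toQ_G4]

/-- The derivations of the quasimodular tower that commute with the action of `SL(2, ℤ)`. -/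
noncomputable def equivariantDerivations : LieSubalgebra ℂ (Derivation ℂ QMTower QMTower) where
  carrier := {δ | ∀ γ f, δ (dslash (toQ γ) f) = dslash (toQ γ) (δ f)}
  add_mem' hδ hε γ f := by simp only [Derivation.add_apply, hδ γ f, hε γ f, map_add]
  zero_mem' γ f := by simp only [Derivation.zero_apply, map_zero]
  smul_mem' c δ hδ γ f := by simp only [Derivation.smul_apply, hδ γ f, map_smul]
  lie_mem' {δ ε} hδ hε γ f := by
    simp only [Derivation.commutator_apply, hδ γ _, hε γ _, map_sub]

theorem mem_equivariantDerivations {δ : Derivation ℂ QMTower QMTower} :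
    δ ∈ equivariantDerivations ↔ ∀ γ f, δ (dslash (toQ γ) f) = dslash (toQ γ) (δ f) := Iff.rfl

theorem smul_dG2Derivation_mem {s : QMTower} (hs : s ∈ levelOne) :
    s • dG2Derivation ∈ equivariantDerivations := fun γ f => by
  simp only [Derivation.smul_apply, smul_eq_mul, map_mul, dG2Derivation_dslash,
    mem_levelOne.mp hs γ]

end LevelOne

section Product

variable {N : ℕ}

theorem toQ_mem_GammaQ {γ : SL(2, ℤ)} (hγ : γ ∈ Gamma N) : toQ γ ∈ GammaQ N := ⟨γ, hγ, rfl⟩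

theorem Q.apply_toQ_mul (F : Q N) {γ : SL(2, ℤ)} (hγ : γ ∈ Gamma N) (α : GL(2, ℚ)⁺) :
    F.1 (toQ γ * α) = F.1 α := F.2.1 _ (toQ_mem_GammaQ hγ) α

theorem Q.apply_mul_toQ (F : Q N) {γ : SL(2, ℤ)} (hγ : γ ∈ Gamma N) (α : GL(2, ℚ)⁺) :
    F.1 (α * toQ γ) = dslash (toQ γ) (F.1 α) := F.2.2.2 _ (toQ_mem_GammaQ hγ) α

theorem Q.dslash_apply_mul_inv (F : Q N) (α : GL(2, ℚ)⁺) {γ : SL(2, ℤ)} (hγ : γ ∈ Gamma N)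
    (β : SL(2, ℤ)) : dslash (toQ (γ * β)) (F.1 (α * (toQ (γ * β))⁻¹)) =
      dslash (toQ β) (F.1 (α * (toQ β)⁻¹)) := by
  rw [map_mul, dslash_mul, ← Q.apply_mul_toQ F hγ, mul_inv_rev, mul_assoc, inv_mul_cancel_right]

variable [NeZero N]

instance finite_rightCosets_Gamma : Finite (Quotient (QuotientGroup.rightRel (Gamma N))) :=
  Finite.of_equiv _ (QuotientGroup.quotientRightRelEquivQuotientLeftRel (Gamma N)).symm

noncomputable instance fintype_rightCosets_Gamma :
    Fintype (Quotient (QuotientGroup.rightRel (Gamma N))) := Fintype.ofFinite _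

theorem starR_eq_sum (F G : GL(2, ℚ)⁺ → QMTower) (α : GL(2, ℚ)⁺) :
    starR N F G α = ∑ q : Quotient (QuotientGroup.rightRel (Gamma N)),
      F (toQ q.out) * dslash (toQ q.out) (G (α * (toQ q.out)⁻¹)) :=
  finsum_eq_sum_of_fintype _

theorem starR_toQ_mul (F : GL(2, ℚ)⁺ → QMTower) (G : Q N) {γ : SL(2, ℤ)} (hγ : γ ∈ Gamma N)
    (α : GL(2, ℚ)⁺) : starR N F G.1 (toQ γ * α) = starR N F G.1 α := by
  simp only [starR_eq_sum, mul_assoc, Q.apply_toQ_mul G hγ]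

theorem starR_mul_toQ (F G : Q N) {δ : SL(2, ℤ)} (hδ : δ ∈ Gamma N) (α : GL(2, ℚ)⁺) :
    starR N F.1 G.1 (α * toQ δ) = dslash (toQ δ) (starR N F.1 G.1 α) := by
  simp only [starR_eq_sum, map_sum, map_mul (dslash (toQ δ))]
  rw [← sum_out_mul_right (Γ := Gamma N) (φ := fun β => F.1 (toQ β) *
    dslash (toQ β) (G.1 (α * toQ δ * (toQ β)⁻¹))) (fun γ hγ β => ?_) δ]
  · refine Finset.sum_congr rfl fun q _ => ?_
    rw [map_mul toQ, Q.apply_mul_toQ F hδ, dslash_mul, mul_inv_rev, mul_assoc α,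
      mul_inv_cancel_left]
  · rw [Q.dslash_apply_mul_inv G _ hγ, map_mul, Q.apply_toQ_mul F hγ]

theorem finite_rightCosets_support_starR (F : GL(2, ℚ)⁺ → QMTower) (G : Q N) :
    (Quotient.mk (QuotientGroup.rightRel (GammaQ N)) ''
      Function.support (starR N F G.1)).Finite := by
  refine (Set.finite_iUnion fun q : Quotient (QuotientGroup.rightRel (Gamma N)) =>
    finite_rightCosets_image_mul_right G.2.2.1 (toQ q.out)).subset ?_
  rintro _ ⟨α, hα, rfl⟩
  rw [Function.mem_support, starR_eq_sum] at hα
  obtain ⟨q, -, hq⟩ := Finset.exists_ne_zero_of_sum_ne_zero hα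
  have hG : G.1 (α * (toQ q.out)⁻¹) ≠ 0 := fun h => hq (by rw [h, map_zero, mul_zero])
  exact Set.mem_iUnion.mpr ⟨q, α, ⟨_, hG, inv_mul_cancel_right _ _⟩, rfl⟩

theorem starR_mem (F G : Q N) : starR N F.1 G.1 ∈ Q N := by
  refine ⟨?_, finite_rightCosets_support_starR F.1 G, ?_⟩
  · rintro _ ⟨γ, hγ, rfl⟩ α
    exact starR_toQ_mul F.1 G hγ α
  · rintro _ ⟨γ, hγ, rfl⟩ α
    exact starR_mul_toQ F G hγ α

/-- The product `∗ʳ` on `Q N` as a bilinear map. -/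
noncomputable def Q.mul : Q N →ₗ[ℂ] Q N →ₗ[ℂ] Q N :=
  LinearMap.mk₂ ℂ (fun F G => ⟨starR N F.1 G.1, starR_mem F G⟩)
    (fun F F' G => Subtype.ext <| funext fun α => by
      simp only [starR_eq_sum, Submodule.coe_add, Pi.add_apply, add_mul, Finset.sum_add_distrib])
    (fun c F G => Subtype.ext <| funext fun α => by
      simp only [starR_eq_sum, Submodule.coe_smul, Pi.smul_apply, smul_mul_assoc, Finset.smul_sum])
    (fun F G G' => Subtype.ext <| funext fun α => by
      simp only [starR_eq_sum, Submodule.coe_add, Pi.add_apply, map_add, mul_add,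
        Finset.sum_add_distrib])
    (fun c F G => Subtype.ext <| funext fun α => by
      simp only [starR_eq_sum, Submodule.coe_smul, Pi.smul_apply, map_smul, mul_smul_comm,
        Finset.smul_sum])

theorem Q.mul_apply (F G : Q N) (α : GL(2, ℚ)⁺) : (Q.mul F G).1 α = starR N F.1 G.1 α := rfl

theorem Q.mul_assoc (F G K : Q N) : Q.mul (Q.mul F G) K = Q.mul F (Q.mul G K) := by
  refine Subtype.ext (funext fun α => ?_)
  simp only [Q.mul_apply, starR_eq_sum, map_sum, map_mul, Finset.sum_mul, Finset.mul_sum]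
  rw [Finset.sum_comm]
  refine Finset.sum_congr rfl fun r _ => ?_
  rw [← sum_out_mul_right (Γ := Gamma N) (φ := fun β => F.1 (toQ r.out) *
    dslash (toQ r.out) (G.1 (toQ β * (toQ r.out)⁻¹)) *
      dslash (toQ β) (K.1 (α * (toQ β)⁻¹))) (fun γ hγ β => ?_) r.out]
  · refine Finset.sum_congr rfl fun q _ => ?_
    rw [map_mul, mul_inv_cancel_right, dslash_mul, mul_inv_rev, _root_.mul_assoc,
      _root_.mul_assoc α]
  · rw [Q.dslash_apply_mul_inv K α hγ, map_mul, _root_.mul_assoc (toQ γ), Q.apply_toQ_mul G hγ]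

end Product

section Operators

variable {N : ℕ}

/-- The endomorphism of `Q N` given by a family of endomorphisms of the quasimodular tower that is
compatible with the action of `Γ(N)`. -/
noncomputable def Q.componentwise (T : GL(2, ℚ)⁺ → Module.End ℂ QMTower)
    (hleft : ∀ γ ∈ Gamma N, ∀ α, T (toQ γ * α) = T α)
    (hright : ∀ γ ∈ Gamma N, ∀ α f,
      T (α * toQ γ) (dslash (toQ γ) f) = dslash (toQ γ) (T α f)) : Module.End ℂ (Q N) where
  toFun F := ⟨fun α => T α (F.1 α), by
    refine ⟨?_, F.2.2.1.subset (Set.image_mono fun α hα h => hα ?_), ?_⟩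
    · rintro _ ⟨γ, hγ, rfl⟩ α
      simp only [hleft γ hγ, Q.apply_toQ_mul F hγ]
    · simp only [h, map_zero]
    · rintro _ ⟨γ, hγ, rfl⟩ α
      simp only [Q.apply_mul_toQ F hγ, hright γ hγ]⟩
  map_add' F G := Subtype.ext <| funext fun α => map_add (T α) _ _
  map_smul' c F := Subtype.ext <| funext fun α => map_smul (T α) c _

variable [NeZero N]

theorem Q.componentwise_mem_derivations {T : GL(2, ℚ)⁺ → Module.End ℂ QMTower} {hleft hright}
    (hT : ∀ α (β : SL(2, ℤ)) x y, T α (x * dslash (toQ β) y) =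
      T (toQ β) x * dslash (toQ β) y + x * dslash (toQ β) (T (α * (toQ β)⁻¹) y)) :
    Q.componentwise (N := N) T hleft hright ∈ derivations (Q.mul (N := N)) := by
  refine mem_derivations.mpr fun F G => Subtype.ext <| funext fun α => ?_
  simp only [Q.componentwise, LinearMap.coe_mk, AddHom.coe_mk, Submodule.coe_add, Pi.add_apply,
    Q.mul_apply, starR_eq_sum, map_sum, hT, Finset.sum_add_distrib]

attribute [local instance 100] LieRing.ofAssociativeRing

/-- An equivariant derivation of the quasimodular tower acts on `Q N` component by component. -/
noncomputable def Q.derivationAction :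
    equivariantDerivations →ₗ⁅ℂ⁆ derivations (Q.mul (N := N)) where
  toFun δ := ⟨Q.componentwise (fun _ => δ.1) (fun _ _ _ => rfl) fun γ _ _ f => δ.2 γ f,
    Q.componentwise_mem_derivations fun _ β x y => by
      simp [mem_equivariantDerivations.mp δ.2 β, add_comm, mul_comm]⟩
  map_add' δ ε := rfl
  map_smul' c δ := rfl
  map_lie' {δ ε} := Subtype.ext <| LinearMap.ext fun F => Subtype.ext <| funext fun α =>
    Derivation.commutator_apply (F.1 α)

theorem Q.derivationAction_apply (δ : equivariantDerivations) (F : Q N) (α : GL(2, ℚ)⁺) :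
    ((Q.derivationAction δ).1 F).1 α = δ.1 (F.1 α) := rfl

/-- Multiplication by the coboundary `α ↦ g || α - g` of a form `g` of level one. -/
noncomputable def Q.mulCoboundary (g : levelOne) : derivations (Q.mul (N := N)) :=
  ⟨Q.componentwise (fun α => LinearMap.mulLeft ℂ (dslash α g.1 - g.1))
    (fun γ _ α => by rw [dslash_mul, mem_levelOne.mp g.2])
    (fun γ _ α f => by
      simp only [LinearMap.mulLeft_apply, dslash_mul, map_mul, map_sub, mem_levelOne.mp g.2]),
  Q.componentwise_mem_derivations fun α β x y => by
    have h : dslash (toQ β) (dslash (α * (toQ β)⁻¹) g.1) = dslash α g.1 := by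
      rw [← dslash_mul, inv_mul_cancel_right]
    simp only [LinearMap.mulLeft_apply, map_mul, map_sub, mem_levelOne.mp g.2, h]
    ring⟩

theorem Q.mulCoboundary_apply (g : levelOne) (F : Q N) (α : GL(2, ℚ)⁺) :
    ((Q.mulCoboundary g).1 F).1 α = (dslash α g.1 - g.1) * F.1 α := rfl

theorem Q.commute_mulCoboundary (g h : levelOne) :
    Commute (Q.mulCoboundary (N := N) g).1 (Q.mulCoboundary h).1 :=
  LinearMap.ext fun _ => Subtype.ext <| funext fun _ => mul_left_comm _ _ _

theorem Q.commute_derivationAction_mulCoboundary {δ : equivariantDerivations} {g : levelOne}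
    (h : ∀ α, δ.1 (dslash α g.1) = 0) :
    Commute (Q.derivationAction (N := N) δ).1 (Q.mulCoboundary g).1 := by
  have hg : δ.1 g.1 = 0 := by simpa only [mem_levelOne.mp g.2] using h (toQ 1)
  refine LinearMap.ext fun F => Subtype.ext <| funext fun α => ?_
  simp only [Module.End.mul_apply, Q.derivationAction_apply, Q.mulCoboundary_apply,
    Derivation.leibniz, map_sub, h α, hg, sub_zero, mul_zero, add_zero, smul_eq_mul]

/-- The derivation `G_4^l G_2^(k-1) d/dG_2`; here `k - 1` is truncated for `k = 0`. -/
noncomputable def derivationT (k l : ℕ) : equivariantDerivations :=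
  ⟨(incl G4 ^ l * G2 ^ (k - 1)) • dG2Derivation, smul_dG2Derivation_mem <|
    mul_mem (pow_mem incl_G4_mem_levelOne l) (pow_mem G2_mem_levelOne (k - 1))⟩

theorem lie_derivationT {k k' : ℕ} (hk : 0 < k) (hk' : 0 < k') (l l' : ℕ) :
    ⁅derivationT k l, derivationT k' l'⁆ =
      ((k' : ℂ) - k) • derivationT (k + k' - 2) (l + l') := by
  refine Subtype.ext ((lie_pow_mul_pow_smul_derivation dG2Derivation_G2
    (dG2Derivation_incl G4) l l' (k - 1) (k' - 1)).trans ?_)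
  rw [show k - 1 + (k' - 1) - 1 = k + k' - 2 - 1 by omega, Nat.cast_sub hk', Nat.cast_sub hk,
    sub_sub_sub_cancel_right]
  rfl

/-- The operator `D` as a derivation: by Ramanujan's identity it is `1/2 T_3^0 - 5/24 T_1^1`. -/
noncomputable def derivationD : equivariantDerivations :=
  (1 / 2 : ℂ) • derivationT 3 0 - (5 / 24 : ℂ) • derivationT 1 1

theorem lie_derivationT_derivationD (k : ℕ) (hk : 0 < k) (l : ℕ) :
    ⁅derivationT k l, derivationD⁆ =
      (5 / 24 * ((k : ℂ) - 1)) • derivationT (k - 1) (l + 1) -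
        (1 / 2 * ((k : ℂ) - 3)) • derivationT (k + 1) l := by
  rw [derivationD, lie_sub, lie_smul, lie_smul, lie_derivationT hk three_pos,
    lie_derivationT hk one_pos, show k + 3 - 2 = k + 1 by omega, show k + 1 - 2 = k - 1 by omega]
  module

end Operators

/-! ### Ramanujan's identity for the derivative of `G₂` -/

section Cusp

open Filter Topology

theorem periodic_qParam {h : ℝ} (hh : h ≠ 0) :
    Function.Periodic (Function.Periodic.qParam h) h := by
  intro z
  have hh' : (h : ℂ) ≠ 0 := Complex.ofReal_ne_zero.mpr hh
  rw [Function.Periodic.qParam, mul_add, add_div, mul_div_cancel_right₀ _ hh', Complex.exp_add,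
    Complex.exp_two_pi_mul_I, mul_one, Function.Periodic.qParam]

theorem periodic_comp_ofComplex_of_hasSum_qParam {f : ℍ → ℂ} {h : ℝ} (hh : h ≠ 0) {c : ℕ → ℂ}
    (hc : ∀ τ : ℍ, HasSum (fun m => c m • Function.Periodic.qParam h τ ^ m) (f τ)) :
    Function.Periodic (f ∘ ofComplex) h := by
  intro w
  rcases le_or_gt w.im 0 with hw | hw
  · rw [Function.comp_apply, Function.comp_apply, ofComplex_apply_of_im_nonpos hw,
      ofComplex_apply_of_im_nonpos (by simpa using hw)]
  · have hw' : 0 < (w + h).im := by simpa using hw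
    rw [Function.comp_apply, Function.comp_apply, ofComplex_apply_of_im_pos hw,
      ofComplex_apply_of_im_pos hw']
    have hsum := hc ⟨w + h, hw'⟩
    rw [coe_mk, periodic_qParam hh w] at hsum
    exact hsum.unique (hc ⟨w, hw⟩)

theorem tendsto_atImInfty_of_hasSum_qParam {f : ℍ → ℂ} {h : ℝ} (hh : 0 < h) (hf : MDiff f)
    (hb : IsBoundedAtImInfty f) {c : ℕ → ℂ}
    (hc : ∀ τ : ℍ, HasSum (fun m => c m • Function.Periodic.qParam h τ ^ m) (f τ)) :
    Tendsto f atImInfty (𝓝 (c 0)) := by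
  have hper := periodic_comp_ofComplex_of_hasSum_qParam hh.ne' hc
  have han := analyticAt_cuspFunction_zero hh hper hf hb
  have hc₀ : cuspFunction h f 0 = c 0 := by
    simpa using
      ((hasFPowerSeriesOnBall_cuspFunction hh han hc).hasFPowerSeriesAt.coeff_zero 0).symm
  rw [← hc₀]
  exact (han.continuousAt.tendsto.comp (qParam_tendsto_atImInfty hh)).congr fun τ =>
    eq_cuspFunction τ hh.ne' hper

theorem tendsto_eisensteinG_two : Tendsto (eisensteinG 2) atImInfty (𝓝 (-1 / 24)) := by
  have hE₂ : Tendsto EisensteinSeries.E2 atImInfty (𝓝 1) := by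
    refine tendsto_atImInfty_of_hasSum_qParam (c := fun m : ℕ ↦
      (if m = 0 then 1 else -24 * ArithmeticFunction.sigma 1 m : ℂ)) one_pos E2_mdifferentiable
      EisensteinSeries.isBoundedAtImInfty_E2 fun τ => ?_
    simpa only [Function.Periodic.qParam, Complex.ofReal_one, div_one] using
      EisensteinSeries.hasSum_qExpansion_E2 (z := τ)
  rw [eisensteinG_two]
  simpa using! hE₂.const_smul (-1 / 24 : ℂ)

theorem tendsto_E₄ : Tendsto ModularForm.E₄ atImInfty (𝓝 1) := by
  have h := tendsto_atImInfty_of_hasSum_qParam (f := ModularForm.E₄) one_pos ModularForm.E₄.holo'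
    (ModularFormClass.bdd_at_infty _)
    (ModularForm.hasSum_qExpansion (h := 1) ModularForm.E₄ one_pos (by simp))
  rwa [EisensteinSeries.E_qExpansion_coeff_zero _ (by decide)] at h

theorem im_sub_le_im_of_mem_closedBall {z w : ℂ} {r : ℝ} (hw : w ∈ Metric.closedBall z r) :
    z.im - r ≤ w.im := by
  have h := (Complex.abs_im_le_norm (w - z)).trans (mem_closedBall_iff_norm.mp hw)
  rw [Complex.sub_im, abs_le] at h
  linarith

theorem tendsto_deriv_comp_ofComplex_atImInfty {f : ℍ → ℂ} (hf : MDiff f) {c : ℂ}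
    (h : Tendsto f atImInfty (𝓝 c)) :
    Tendsto (fun z : ℍ => deriv (f ∘ ofComplex) z) atImInfty (𝓝 0) := by
  rw [Metric.tendsto_nhds] at h ⊢
  intro ε hε
  obtain ⟨A, hA⟩ := (atImInfty_mem _).mp (h (ε / 2) (half_pos hε))
  refine (atImInfty_mem _).mpr ⟨max A 0 + 2, fun z hz => ?_⟩
  have him : ∀ w ∈ Metric.closedBall (z : ℂ) 1, max A 0 < w.im := fun w hw => by
    have hz' : max A 0 + 2 ≤ (z : ℂ).im := hz
    linarith [im_sub_le_im_of_mem_closedBall hw]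
  have hcauchy : ‖deriv (fun w => (f ∘ ofComplex) w - c) (z : ℂ)‖ ≤ ε / 2 / 1 := by
    refine Complex.norm_deriv_le_of_forall_mem_sphere_norm_le one_pos ?_ fun w hw => ?_
    · exact ((UpperHalfPlane.mdifferentiable_iff.mp hf).sub_const c).diffContOnCl_ball
        fun w hw => (le_max_right A 0).trans_lt (him w hw)
    · have hw' := him w (Metric.sphere_subset_closedBall hw)
      rw [Function.comp_apply, ofComplex_apply_of_im_pos ((le_max_right A 0).trans_lt hw'),
        ← dist_eq_norm]
      exact (hA ⟨w, _⟩ ((le_max_left A 0).trans hw'.le)).le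
  rw [deriv_sub_const, div_one] at hcauchy
  exact (dist_zero_right (deriv (f ∘ ofComplex) z)).trans_lt
    (hcauchy.trans_lt (half_lt_self hε))

end Cusp

section Ramanujan

open Filter Topology

theorem eq_smul_E₄_of_tendsto_atImInfty {f : ModularForm 𝒮ℒ 4} {c : ℂ}
    (hf : Tendsto f atImInfty (𝓝 c)) : f = c • ModularForm.E₄ := by
  obtain ⟨d, rfl⟩ := (finrank_eq_one_iff_of_nonzero' ModularForm.E₄
    (EisensteinSeries.E_ne_zero _ (by decide))).mp
    (Module.rank_eq_one_iff_finrank_eq_one.mp ModularForm.levelOne_weight_four_rank_one) f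
  have hd : Tendsto (d • ModularForm.E₄ : ModularForm 𝒮ℒ 4) atImInfty (𝓝 d) := by
    simpa using! tendsto_E₄.const_smul d
  rw [tendsto_nhds_unique hf hd]

/-- The combination `G_2' + 4πi G_2^2`, in which the nonmodular parts of the two summands
cancel. -/
noncomputable def eisensteinG2Serre : ℍ → ℂ :=
  eisensteinG2' + (4 * Real.pi * Complex.I : ℂ) • eisensteinG 2 ^ 2

theorem eisensteinG2Serre_slash (γ : SL(2, ℤ)) :
    eisensteinG2Serre ∣[(4 : ℤ)] γ = eisensteinG2Serre := by
  ext z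
  rw [eisensteinG2Serre, SlashAction.add_slash, ModularForm.SL_smul_slash, pow_two,
    show (4 : ℤ) = 2 + 2 by norm_num, ModularForm.mul_slash_SL2, eisensteinG_two_slash]
  simp only [Pi.add_apply, Pi.smul_apply, Pi.mul_apply, smul_eq_mul]
  rw [show (2 + 2 : ℤ) = 4 by norm_num, eisensteinG2'_slash, g2const]
  have h : (Real.pi : ℂ) ≠ 0 := Complex.ofReal_ne_zero.mpr Real.pi_ne_zero
  field_simp
  linear_combination (8 * eisensteinG 2 z * cocyc γ z * Real.pi +
    Complex.I * cocyc γ z ^ 2) * Complex.I_sq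

theorem exists_modularForm_eq_eisensteinG2Serre :
    ∃ g : ModularForm 𝒮ℒ 4, ⇑g = eisensteinG2Serre := by
  rw [← Gamma_one_coe_eq_SL]
  refine modularForm_iff.mpr ⟨isQuasimodularWith_eisensteinG2'.holo.add
    (mdiff_smul _ (mdiff_eisensteinG_two.pow 2)), fun γ _ => eisensteinG2Serre_slash γ,
    fun δ => ?_⟩
  rw [eisensteinG2Serre_slash, eisensteinG2Serre, pow_two]
  exact bdd_add bdd_eisensteinG2' (bdd_smul _ (bdd_mul bdd_eisensteinG_two bdd_eisensteinG_two))

theorem tendsto_eisensteinG2Serre :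
    Tendsto eisensteinG2Serre atImInfty (𝓝 (Real.pi * Complex.I / 144)) := by
  have h := (tendsto_deriv_comp_ofComplex_atImInfty mdiff_eisensteinG_two
    tendsto_eisensteinG_two).add
      ((tendsto_eisensteinG_two.pow 2).const_smul (4 * Real.pi * Complex.I : ℂ))
  rw [show Real.pi * Complex.I / 144 =
    0 + (4 * Real.pi * Complex.I : ℂ) • (-1 / 24 : ℂ) ^ 2 by rw [smul_eq_mul]; ring]
  exact h

theorem eisensteinG2'_ramanujan : eisensteinG2' = (2 * Real.pi * Complex.I : ℂ) •
    ((-2 : ℂ) • eisensteinG 2 ^ 2 + (5 / 6 : ℂ) • eisensteinG 4) := by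
  obtain ⟨g, hg⟩ := exists_modularForm_eq_eisensteinG2Serre
  have hlim : Tendsto g atImInfty (𝓝 (Real.pi * Complex.I / 144)) := by
    rw [hg]
    exact tendsto_eisensteinG2Serre
  have hE₄ : eisensteinG2Serre = (Real.pi * Complex.I / 144 : ℂ) • ⇑ModularForm.E₄ := by
    rw [← hg, eq_smul_E₄_of_tendsto_atImInfty hlim]
    rfl
  rw [eq_sub_of_add_eq hE₄, eisensteinG_four]
  ext z
  simp only [Pi.add_apply, Pi.sub_apply, Pi.smul_apply, Pi.pow_apply, smul_eq_mul]
  ring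

theorem G2'_eq : G2' = (2 * Real.pi * Complex.I : ℂ) •
    ((-2 : ℂ) • G2 ^ 2 + (5 / 6 : ℂ) • incl G4) := by
  obtain ⟨h, hG2⟩ := G2_pow 2
  rw [hG2, G4, incl_of, ← map_smul, ← map_smul, ← map_add, ← map_smul]
  exact congrArg (Tower.of quasimodularSpace 4) (Subtype.ext eisensteinG2'_ramanujan)

end Ramanujan

section Operators

theorem opD_eq_derivationD (f : QMTower) : opD f = derivationD.1 f := by
  have hπ : (Real.pi : ℂ) ≠ 0 := Complex.ofReal_ne_zero.mpr Real.pi_ne_zero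
  have hc : -(1 / (8 * Real.pi * Complex.I)) * (2 * Real.pi * Complex.I) = (-1 / 4 : ℂ) := by
    field_simp
    norm_num
  change (-(1 / (8 * Real.pi * Complex.I)) : ℂ) • (dG2 f * G2') =
    (1 / 2 : ℂ) • (incl G4 ^ 0 * G2 ^ 2 * dG2 f) - (5 / 24 : ℂ) • (incl G4 ^ 1 * G2 ^ 0 * dG2 f)
  rw [G2'_eq, mul_smul_comm, smul_smul, hc]
  algebra

theorem opT_eq_derivationT (k : ℕ+) (l : ℕ) (f : QMTower) : opT k l f = (derivationT k l).1 f := by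
  change (opE ^ l) (G2 ^ ((k : ℕ) - 1) * dG2 f) = incl G4 ^ l * G2 ^ ((k : ℕ) - 1) * dG2 f
  rw [opE, LinearMap.pow_mulLeft, LinearMap.mulLeft_apply, mul_assoc]

theorem derivationT_dslash_incl (k l : ℕ) (α : GL(2, ℚ)⁺) (a : MTower) :
    (derivationT k l).1 (dslash α (incl a)) = 0 := by
  rw [dslash_incl, derivationT, Derivation.smul_apply, dG2Derivation_incl, smul_zero]

theorem derivationD_dslash_incl (α : GL(2, ℚ)⁺) (a : MTower) :
    derivationD.1 (dslash α (incl a)) = 0 := by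
  change (1 / 2 : ℂ) • (derivationT 3 0).1 _ - (5 / 24 : ℂ) • (derivationT 1 1).1 _ = 0
  rw [derivationT_dslash_incl, derivationT_dslash_incl, smul_zero, smul_zero, sub_zero]

/-- The form of level one whose coboundary is `ν^(m)`. -/
noncomputable def nuPotential (m : ℕ+) : levelOne :=
  ⟨incl ((-(5 / 24) : ℂ) • G4 ^ (m : ℕ)), by
    rw [map_smul, map_pow]
    exact levelOne.smul_mem (pow_mem incl_G4_mem_levelOne _) _⟩

theorem dslash_nuPotential_sub (m : ℕ+) (α : GL(2, ℚ)⁺) :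
    dslash α (nuPotential m).1 - (nuPotential m).1 = incl (nu m α) := by
  rw [nuPotential, dslash_incl, ← map_sub, nu, map_smul, smul_sub]

end Operators

/-! ### The Hopf action -/

section Presentation

variable {𝔤 : Type*} [LieRing 𝔤] [LieAlgebra ℂ 𝔤] (ψ : equivariantDerivations →ₗ⁅ℂ⁆ 𝔤) (p : ℕ+ → 𝔤)

/-- The assignment on generators that is `ψ` on the derivations `D`, `T_k^l` and `p m` on
`φ^(m)`. -/
noncomputable def Gen.assign : Gen → 𝔤
  | D => ψ derivationD
  | T k l => ψ (derivationT k l)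
  | φ m => p m

theorem lift_assign_sym (g : Gen) : FreeLieAlgebra.lift ℂ (Gen.assign ψ p) g.sym = g.assign ψ p :=
  FreeLieAlgebra.lift_of_apply _ g

theorem smul_lift_assign_symT {c : ℂ} {k : ℕ} (l : ℕ) (hc : k = 0 → c = 0) :
    c • FreeLieAlgebra.lift ℂ (Gen.assign ψ p) (Gen.symT k l) = ψ (c • derivationT k l) := by
  rcases Nat.eq_zero_or_pos k with rfl | hk
  · simp only [hc rfl, zero_smul, map_zero]
  · rw [Gen.symT, dif_pos hk, lift_assign_sym, map_smul]
    rfl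

variable {ψ p}

theorem lift_assign_eq_zero_of_relator (hD : ∀ m, ⁅ψ derivationD, p m⁆ = 0)
    (hT : ∀ (k : ℕ+) l m, ⁅ψ (derivationT k l), p m⁆ = 0) (hφ : ∀ m m', ⁅p m, p m'⁆ = 0)
    {x : FreeLieAlgebra ℂ Gen} (hx : Gen.Relator x) :
    FreeLieAlgebra.lift ℂ (Gen.assign ψ p) x = 0 := by
  cases hx with
  | Dφ m => simpa only [LieHom.map_lie, lift_assign_sym, Gen.assign] using hD m
  | Tφ k l m => simpa only [LieHom.map_lie, lift_assign_sym, Gen.assign] using hT k l m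
  | φφ m m' => simpa only [LieHom.map_lie, lift_assign_sym, Gen.assign] using hφ m m'
  | TT k k' l l' =>
    have hc : (k + k' - 2 : ℕ) = 0 → (k' : ℂ) - k = 0 := fun h => by
      rw [show (k' : ℕ) = k by have := k.pos; have := k'.pos; omega, sub_self]
    rw [map_sub, map_smul, smul_lift_assign_symT _ _ _ hc, LieHom.map_lie, lift_assign_sym,
      lift_assign_sym, ← lie_derivationT k.pos k'.pos, LieHom.map_lie]
    exact sub_self _
  | TD k l =>
    have hc : (k - 1 : ℕ) = 0 → (5 / 24 * ((k : ℂ) - 1)) = 0 := fun h => by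
      rw [show (k : ℕ) = 1 by have := k.pos; omega, Nat.cast_one, sub_self, mul_zero]
    rw [map_sub, map_sub, map_smul, map_smul, smul_lift_assign_symT _ _ _ hc,
      smul_lift_assign_symT _ _ _ (absurd · (Nat.succ_ne_zero _)), LieHom.map_lie,
      lift_assign_sym, lift_assign_sym, ← map_sub, ← lie_derivationT_derivationD k k.pos,
      LieHom.map_lie]
    exact sub_self _

/-- The homomorphism on the presented Lie algebra determined by `Gen.assign`. -/
noncomputable def L.lift (hD : ∀ m, ⁅ψ derivationD, p m⁆ = 0)
    (hT : ∀ (k : ℕ+) l m, ⁅ψ (derivationT k l), p m⁆ = 0) (hφ : ∀ m m', ⁅p m, p m'⁆ = 0) :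
    L →ₗ⁅ℂ⁆ 𝔤 :=
  lieQuotientLift _ (FreeLieAlgebra.lift ℂ (Gen.assign ψ p)) <| LieSubmodule.lieSpan_le.mpr
    fun _ hx => LieHom.mem_ker.mpr (lift_assign_eq_zero_of_relator hD hT hφ hx)

theorem L.lift_mk_sym (hD : ∀ m, ⁅ψ derivationD, p m⁆ = 0)
    (hT : ∀ (k : ℕ+) l m, ⁅ψ (derivationT k l), p m⁆ = 0) (hφ : ∀ m m', ⁅p m, p m'⁆ = 0)
    (g : Gen) : L.lift hD hT hφ (LieSubmodule.Quotient.mk g.sym) = g.assign ψ p :=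
  lift_assign_sym ψ p g

end Presentation

section HopfAction

variable (N : ℕ) [NeZero N]

attribute [local instance 100] LieRing.ofAssociativeRing

/-- The action of the Lie algebra on `Q N` by derivations of the product. -/
noncomputable def lieAction : L →ₗ⁅ℂ⁆ derivations (Q.mul (N := N)) :=
  L.lift (ψ := Q.derivationAction) (p := fun m => Q.mulCoboundary (nuPotential m))
    (fun _ => Subtype.ext <| commute_iff_lie_eq.mp <|
      Q.commute_derivationAction_mulCoboundary fun α => derivationD_dslash_incl α _)
    (fun k l _ => Subtype.ext <| commute_iff_lie_eq.mp <|
      Q.commute_derivationAction_mulCoboundary fun α => derivationT_dslash_incl k l α _)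
    (fun _ _ => Subtype.ext <| commute_iff_lie_eq.mp <| Q.commute_mulCoboundary _ _)

/-- The action of the Hopf algebra on `Q N`. -/
noncomputable def hopfAction : H →ₐ[ℂ] Module.End ℂ (Q N) :=
  UniversalEnvelopingAlgebra.lift ℂ ((derivations Q.mul).incl.comp (lieAction N))

theorem hopfAction_ι (x : L) :
    hopfAction N (UniversalEnvelopingAlgebra.ι ℂ x) = (lieAction N x).1 :=
  UniversalEnvelopingAlgebra.lift_ι_apply ℂ _ x

theorem hopfAction_toH (g : Gen) : hopfAction N g.toH =
    (g.assign Q.derivationAction fun m => Q.mulCoboundary (N := N) (nuPotential m)).1 := by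
  rw [Gen.toH, hopfAction_ι, lieAction, L.lift_mk_sym]

variable {N}

theorem hopfAction_D_apply (F : Q N) (α : GL(2, ℚ)⁺) :
    (hopfAction N Gen.D.toH F).1 α = opD (F.1 α) := by
  rw [hopfAction_toH, opD_eq_derivationD]
  rfl

theorem hopfAction_T_apply (k : ℕ+) (l : ℕ) (F : Q N) (α : GL(2, ℚ)⁺) :
    (hopfAction N (Gen.T k l).toH F).1 α = opT k l (F.1 α) := by
  rw [hopfAction_toH, opT_eq_derivationT]
  rfl

theorem hopfAction_φ_apply (m : ℕ+) (F : Q N) (α : GL(2, ℚ)⁺) :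
    (hopfAction N (Gen.φ m).toH F).1 α = incl (nu m α) * F.1 α := by
  rw [hopfAction_toH, ← dslash_nuPotential_sub]
  rfl

theorem hopfAction_mul {ι : Type*} {h : H} (r : Coalgebra.Repr ℂ h ι) (F G : Q N) :
    hopfAction N h (Q.mul F G) =
      ∑ i ∈ r.index, Q.mul (hopfAction N (r.left i) F) (hopfAction N (r.right i) G) :=
  apply_eq_sum_of_ι_mem_derivations (fun x => hopfAction_ι N x ▸ (lieAction N x).2) r F G

end HopfAction

end QuasimodularHecke

theorem mainTheorem2 (N : ℕ) (hN : N ≠ 0) :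
    ∃ (mul : Q N →ₗ[ℂ] Q N →ₗ[ℂ] Q N)
      (ρ : H →ₐ[ℂ] Module.End ℂ (Q N)),
      (∀ (F G : Q N) (α : GL(2, ℚ)⁺),
        (mul F G).1 α = starR N F.1 G.1 α) ∧
      (∀ F G K : Q N, mul (mul F G) K = mul F (mul G K)) ∧
      (∀ (F : Q N) (α : GL(2, ℚ)⁺),
        (ρ Gen.D.toH F).1 α = opD (F.1 α)) ∧
      (∀ (k : ℕ+) (l : ℕ) (F : Q N) (α : GL(2, ℚ)⁺),
        (ρ (Gen.T k l).toH F).1 α = opT k l (F.1 α)) ∧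
      (∀ (m : ℕ+) (F : Q N) (α : GL(2, ℚ)⁺),
        (ρ (Gen.φ m).toH F).1 α =
          incl (nu m α) * F.1 α) ∧
      ∀ (h : H) (F G : Q N) (ι : Type)
        (r : Coalgebra.Repr ℂ h ι),
        ρ h (mul F G) = ∑ i ∈ r.index, mul (ρ (r.left i) F) (ρ (r.right i) G) := by
  have : NeZero N := ⟨hN⟩
  exact ⟨Q.mul, hopfAction N, Q.mul_apply, Q.mul_assoc, hopfAction_D_apply, hopfAction_T_apply,
    hopfAction_φ_apply, fun _ F G _ r => hopfAction_mul r F G⟩
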